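/- Let $\mathfrak b>0$ and let $\kappa\ge -\frac1{2\pi}$ be real. For $\mathfrak r>0$ consider the thermodynamic Bethe Ansatz equation of the Sinh-Gordon model $$\varepsilon(\lambda)=2\mathfrak r\sin\Big[\tfrac{\pi}{1+\mathfrak b^2}\Big]\cosh\lambda+\kappa\int_{\mathbb R}K(\lambda-\mu)\ln\big[1+e^{-\varepsilon(\mu)}\big]\,d\mu,\qquad \lambda\in\mathbb R,\qquad K(\lambda)=\frac{4\cosh(\lambda)\sin\big[\frac{\pi}{1+\mathfrak b^2}\big]}{\cosh(2\lambda)-\cos\big[\frac{2\pi}{1+\mathfrak b^2}\big]},$$ for measurable functions $\varepsilon:\mathbb R\to\mathbb R$ such that $\varepsilon(\lambda)-2\mathfrak r\sin\big[\frac{\pi}{1+\mathfrak b^2}\big]\cosh\lambda$ is bounded. (The constant $\kappa$ covers the different sign and normalisation conventions for this equation, in particular $\kappa=1$ and $\kappa=-\frac1{2\pi}$.) Given a solution $\varepsilon$, put $\mathrm g=2\ln[1+e^{-\varepsilon}]$. For an integer $N\ge2$ and $\alpha\in\mathbb R$, put $\tau_N=\ln N$ and $$V_{N;\alpha}(\lambda)=\frac{\mathfrak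 r}{N\tau_N}\cosh(\tau_N\lambda)-\frac{\alpha\lambda}{N}-\int_{\mathbb R}\frac{d\mu}{2\pi N}\,\frac{\mathrm g(\tau_N\mu)}{\cosh[\tau_N(\lambda-\mu)]}.$$ For $\omega_1,\omega_2>0$ put $\overline\omega_a=2\pi\tau_N\omega_a$ and, for a Borel probability measure $\mu$ on $\mathbb R$, $$\mathcal E_N[\mu]=\iint\bigg(\frac{V_{N;\alpha}(s)+V_{N;\alpha}(t)}2-\frac1{2\tau_N}\ln\Big\{\prod_{a=1}^2\sinh\Big(\overline\omega_a\frac{s-t}2\Big)\Big\}\bigg)\,d\mu(s)\,d\mu(t)\in(-\infty,+\infty],$$ where the integrand is $+\infty$ for $s=t$. When both terms are finite, this is $\int V_{N;\alpha}\,d\mu-\frac1{2\tau_N}\iint\ln\{\cdots\}\,d\mu\,d\mu$. Then there is $\mathfrak r_0>0$, depending only on $\mathfrak b$ and $\kappa$, such that for every $\mathfrak r\ge\mathfrak r_0$ the equation for $\varepsilon$ has exactly one solution in the above class and, with this $\varepsilon$, for all $N\ge2$ and $\alpha\in\mathbb R$: 1. the potential $V_{N;\alpha}$ is strictly convex on $\mathbb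 R$; 2. for all $\omega_1,\omega_2>0$, the functional $\mathcal E_N$ has exactly one minimiser among the probability measures on $\mathbb R$ (the equilibrium measure), and its support is a single segment $[a_{N;\alpha},b_{N;\alpha}]$ with $a_{N;\alpha}<b_{N;\alpha}$. -/

import Mathlib

open MeasureTheory

noncomputable section

/-- The kernel `K` of the Sinh-Gordon thermodynamic Bethe Ansatz (TBA) equation. -/
def tbaKernel (b x : ℝ) : ℝ :=
  4 * Real.cosh x * Real.sin (Real.pi / (1 + b ^ 2)) /
    (Real.cosh (2 * x) - Real.cos (2 * Real.pi / (1 + b ^ 2)))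

/-- The driving term `2 r sin(π / (1 + b²)) cosh x` of the TBA equation. -/
def tbaDriving (b r x : ℝ) : ℝ :=
  2 * r * Real.sin (Real.pi / (1 + b ^ 2)) * Real.cosh x

/-- `ε` solves the TBA equation
`ε(x) = 2 r sin(π / (1 + b²)) cosh x + κ ∫ K(x - y) ln(1 + exp(-ε(y))) dy`, and is bounded up to
the (unbounded) driving term. The real number `κ` fixes sign and normalisation of the
convolution term. -/
structure IsTBASolution (κ b r : ℝ) (ε : ℝ → ℝ) : Prop where
  measurable : Measurable ε
  bounded : ∃ C : ℝ, ∀ x : ℝ, |ε x - tbaDriving b r x| ≤ C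
  equation : ∀ x : ℝ, ε x = tbaDriving b r x +
    κ * ∫ y : ℝ, tbaKernel b (x - y) * Real.log (1 + Real.exp (-ε y))

/-- The function `g = 2 ln(1 + exp(-ε))`. -/
def tbaG (ε : ℝ → ℝ) (x : ℝ) : ℝ := 2 * Real.log (1 + Real.exp (-ε x))

/-- The scale `τ_N = ln N`. -/
def tauN (N : ℕ) : ℝ := Real.log N

/-- The rescaled confining potential `V_{N;α}` built from the function `ε`. -/
def potential (ε : ℝ → ℝ) (r α : ℝ) (N : ℕ) (x : ℝ) : ℝ :=
  r / (N * tauN N) * Real.cosh (tauN N * x) - α * x / N -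
    ∫ y : ℝ, 1 / (2 * Real.pi * N) *
      (tbaG ε (tauN N * y) / Real.cosh (tauN N * (x - y)))

/-- The rescaled periods `2 π τ_N ω`. -/
def scaledPeriod (N : ℕ) (ω : ℝ) : ℝ := 2 * Real.pi * tauN N * ω

/-- The two-body factor `sinh(ω̄₁ (s - t) / 2) * sinh(ω̄₂ (s - t) / 2)`. It is positive for
`s ≠ t` and vanishes for `s = t`. -/
def sinhProduct (N : ℕ) (ω₁ ω₂ s t : ℝ) : ℝ :=
  Real.sinh (scaledPeriod N ω₁ * ((s - t) / 2)) * Real.sinh (scaledPeriod N ω₂ * ((s - t) / 2))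

/-- The symmetrised energy density
`(V(s) + V(t)) / 2 - (1 / (2 τ_N)) ln(sinh(ω̄₁ (s - t) / 2) sinh(ω̄₂ (s - t) / 2))`,
with value `+∞` on the diagonal (`ENNReal.log 0 = -∞`). -/
def energyDensity (V : ℝ → ℝ) (N : ℕ) (ω₁ ω₂ : ℝ) (p : ℝ × ℝ) : EReal :=
  (((V p.1 + V p.2) / 2 : ℝ) : EReal) -
    ((1 / (2 * tauN N) : ℝ) : EReal) *
      ENNReal.log (ENNReal.ofReal (sinhProduct N ω₁ ω₂ p.1 p.2))

/-- The energy functional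
`E_N[μ] = ∫ V dμ - (1 / (2 τ_N)) ∬ ln(sinh(ω̄₁ (s - t) / 2) sinh(ω̄₂ (s - t) / 2)) dμ(s) dμ(t)`
of a probability measure `μ`, as an extended real number: the integral of the positive part of
the energy density minus the integral of its negative part (the negative part is bounded for the
potentials used here, so that no `∞ - ∞` occurs, even when `V` is not `μ`-integrable). -/
def energy (V : ℝ → ℝ) (N : ℕ) (ω₁ ω₂ : ℝ) (μ : Measure ℝ) : EReal :=
  ((∫⁻ p, (energyDensity V N ω₁ ω₂ p).toENNReal ∂(μ.prod μ) : ENNReal) : EReal) -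
    ((∫⁻ p, (-energyDensity V N ω₁ ω₂ p).toENNReal ∂(μ.prod μ) : ENNReal) : EReal)

/-- Whenever both terms of the energy functional converge and `μ` has no atoms, `energy` is given
by the familiar two-term formula. -/
theorem energy_eq (V : ℝ → ℝ) (N : ℕ) (ω₁ ω₂ : ℝ) (hω₁ : 0 < ω₁) (hω₂ : 0 < ω₂) (hN : 2 ≤ N)
    (μ : Measure ℝ) [IsProbabilityMeasure μ] [NullSingletonClass μ] (hV : Integrable V μ)
    (hL : Integrable (fun p : ℝ × ℝ => Real.log (sinhProduct N ω₁ ω₂ p.1 p.2)) (μ.prod μ)) :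
    energy V N ω₁ ω₂ μ =
      ((∫ s, V s ∂μ - 1 / (2 * tauN N) *
        ∫ p, Real.log (sinhProduct N ω₁ ω₂ p.1 p.2) ∂(μ.prod μ) : ℝ) : EReal) := by
  have hτ : 0 < tauN N := Real.log_pos (by exact_mod_cast hN)
  have hpos : ∀ p : ℝ × ℝ, p.1 ≠ p.2 → 0 < sinhProduct N ω₁ ω₂ p.1 p.2 := by
    intro p hp
    have h1 : 0 < scaledPeriod N ω₁ := by unfold scaledPeriod; positivity
    have h2 : 0 < scaledPeriod N ω₂ := by unfold scaledPeriod; positivity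
    unfold sinhProduct
    rcases lt_or_gt_of_ne hp with h | h
    · exact mul_pos_of_neg_of_neg
        (Real.sinh_neg_iff.2 (mul_neg_of_pos_of_neg h1 (by linarith)))
        (Real.sinh_neg_iff.2 (mul_neg_of_pos_of_neg h2 (by linarith)))
    · exact mul_pos (Real.sinh_pos_iff.2 (mul_pos h1 (by linarith)))
        (Real.sinh_pos_iff.2 (mul_pos h2 (by linarith)))
  have hdiag : ∀ᵐ p ∂(μ.prod μ), p.1 ≠ p.2 := by
    have hm : MeasurableSet {p : ℝ × ℝ | p.1 ≠ p.2} :=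
      (measurableSet_eq_fun measurable_fst measurable_snd).compl
    rw [Measure.ae_prod_iff_ae_ae hm]
    refine Filter.Eventually.of_forall fun x => ?_
    rw [ae_iff]
    simp [eq_comm]
  let f : ℝ × ℝ → ℝ := fun p =>
    (V p.1 + V p.2) / 2 - 1 / (2 * tauN N) * Real.log (sinhProduct N ω₁ ω₂ p.1 p.2)
  have hd : ∀ᵐ p ∂(μ.prod μ), energyDensity V N ω₁ ω₂ p = ((f p : ℝ) : EReal) := by
    filter_upwards [hdiag] with p hp
    simp only [energyDensity, f, ENNReal.log_ofReal_of_pos (hpos p hp)]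
    norm_cast
  have hV1 : Integrable (fun p : ℝ × ℝ => V p.1) (μ.prod μ) := hV.comp_fst μ
  have hV2 : Integrable (fun p : ℝ × ℝ => V p.2) (μ.prod μ) := hV.comp_snd μ
  have hV12 : Integrable (fun p : ℝ × ℝ => (V p.1 + V p.2) / 2) (μ.prod μ) :=
    (hV1.add hV2).div_const 2
  have hf : Integrable f (μ.prod μ) := hV12.sub (hL.const_mul _)
  have e1 : ∫⁻ p, (energyDensity V N ω₁ ω₂ p).toENNReal ∂(μ.prod μ) =
      ∫⁻ p, ENNReal.ofReal (f p) ∂(μ.prod μ) :=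
    lintegral_congr_ae (by filter_upwards [hd] with p hp; rw [hp]; simp)
  have e2 : ∫⁻ p, (-energyDensity V N ω₁ ω₂ p).toENNReal ∂(μ.prod μ) =
      ∫⁻ p, ENNReal.ofReal (-f p) ∂(μ.prod μ) :=
    lintegral_congr_ae (by
      filter_upwards [hd] with p hp
      rw [hp, ← EReal.coe_neg]; simp)
  have hfi : ∫ p, f p ∂(μ.prod μ) = ∫ s, V s ∂μ - 1 / (2 * tauN N) *
        ∫ p, Real.log (sinhProduct N ω₁ ω₂ p.1 p.2) ∂(μ.prod μ) := by
    have g1 : ∫ p : ℝ × ℝ, V p.1 ∂(μ.prod μ) = ∫ s, V s ∂μ := by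
      simpa using integral_fun_fst (μ := μ) (ν := μ) V
    have g2 : ∫ p : ℝ × ℝ, V p.2 ∂(μ.prod μ) = ∫ s, V s ∂μ := by
      simpa using integral_fun_snd (μ := μ) (ν := μ) V
    simp only [f]
    rw [integral_sub hV12 (hL.const_mul _), integral_div,
      integral_add hV1 hV2, integral_const_mul, g1, g2]
    ring
  have t1 : ∫⁻ p, ENNReal.ofReal (f p) ∂(μ.prod μ) ≠ ⊤ := hf.lintegral_lt_top.ne
  have t2 : ∫⁻ p, ENNReal.ofReal (-f p) ∂(μ.prod μ) ≠ ⊤ := hf.neg.lintegral_lt_top.ne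
  rw [energy, e1, e2, ← hfi, integral_eq_lintegral_pos_part_sub_lintegral_neg_part hf,
    EReal.coe_sub, EReal.coe_ennreal_toReal t1, EReal.coe_ennreal_toReal t2]

/-- `μ` is an equilibrium measure: a probability measure on `ℝ` that minimises the energy among
all probability measures on `ℝ`. -/
structure IsEquilibriumMeasure (V : ℝ → ℝ) (N : ℕ) (ω₁ ω₂ : ℝ) (μ : Measure ℝ) : Prop where
  isProbabilityMeasure : IsProbabilityMeasure μ
  energy_le : ∀ ν : Measure ℝ, IsProbabilityMeasure ν →
    energy V N ω₁ ω₂ μ ≤ energy V N ω₁ ω₂ ν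

end

/-!
The proof has three independent parts.

*TBA equation.* The kernel is positive with the primitive `2 arctan (sinh x / sin (π / (1 + b²)))`,
so its integral is exactly `2π`. For large `r` the equation for the deviation from the driving term
is a contraction of the unit ball of bounded continuous functions (`exists_isTBASolution`), so a
solution stays within distance `1` of the driving term. Uniqueness holds among all solutions
(`IsTBASolution.unique`), because `x ↦ ln (1 + e⁻ˣ)` has Lipschitz constant strictly below `1` on
every half-line `[m, ∞)`, while `|κ| ∫ K ≤ 1` for negative `κ`; for `κ ≥ 0` every solution lies
above the driving term, where the Lipschitz constant is small.

*Strong convexity.* Since `u² / 2 - 1 / cosh u` is convex, convolving `g` with `1 / cosh` costs at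
most `∫ g / (2π)` times the convexity of a quadratic, and `∫ g / (2π) < 6`. Hence `V` is strongly
convex as soon as `r ≥ 6` (`strongConvexOn_potential`, `integral_tbaG_lt`).

*Equilibrium measure.* After adding a constant, the energy is `∬ H dμ dμ` with `H ≥ 0` continuous
into `[0, ∞]`, infinite on the diagonal and strongly convex on each closed half plane bounded by
the diagonal, because `ln sinh` is concave on `(0, ∞)`
(`exists_confiningInteraction_shiftedDensity`). Quantile functions are monotone, so pairs of
quantiles stay in one half plane and the energy is strongly displacement convex
(`ConfiningInteraction.displacement_convex`). Two minimisers therefore have equal quantile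
functions, and the quantile functions of a minimising sequence are Cauchy in `L²`; by Fatou's lemma
the law of an almost everywhere limit is a minimiser.

For the support, mixing the minimiser with competitors shows that its effective potential equals
the minimal energy almost everywhere and is at most the minimal energy on the support. As the
effective potential grows at infinity, the support is compact. On a gap of the support it would be
strongly convex, hence strictly below the minimal energy, and the uniform distribution on the gap
would contradict the first variation (`ConfiningInteraction.not_gap`). A one-point support is
excluded because atoms have infinite energy.
-/

noncomputable section

open Filter Topology

/-! ### The kernel of the TBA equation -/

theorem sin_pi_div_one_add_sq_pos {b : ℝ} (hb : 0 < b) :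
    0 < Real.sin (Real.pi / (1 + b ^ 2)) := by
  have h1 : 1 < 1 + b ^ 2 := by nlinarith
  exact Real.sin_pos_of_pos_of_lt_pi (by positivity) (div_lt_self Real.pi_pos h1)

theorem tbaKernel_eq (b x : ℝ) :
    tbaKernel b x = 2 * (Real.cosh x * Real.sin (Real.pi / (1 + b ^ 2)) /
      (Real.sinh x ^ 2 + Real.sin (Real.pi / (1 + b ^ 2)) ^ 2)) := by
  set θ := Real.pi / (1 + b ^ 2) with hθ
  have h2 : 2 * Real.pi / (1 + b ^ 2) = 2 * θ := by rw [hθ]; ring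
  have h3 : Real.cosh (2 * x) - Real.cos (2 * θ) =
      2 * (Real.sinh x ^ 2 + Real.sin θ ^ 2) := by
    rw [Real.cosh_two_mul, Real.cos_two_mul, Real.cosh_sq, Real.sin_sq]; ring
  rw [tbaKernel, h2, h3, mul_div_assoc']
  by_cases h : Real.sinh x ^ 2 + Real.sin θ ^ 2 = 0
  · simp [h]
  · field_simp
    ring

theorem tbaKernel_nonneg {b : ℝ} (hb : 0 < b) (x : ℝ) : 0 ≤ tbaKernel b x := by
  have := sin_pi_div_one_add_sq_pos hb
  have := Real.cosh_pos x
  rw [tbaKernel_eq]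
  positivity

theorem continuous_tbaKernel {b : ℝ} (hb : 0 < b) : Continuous (tbaKernel b) := by
  have h := sin_pi_div_one_add_sq_pos hb
  have e : tbaKernel b = fun x => 2 * (Real.cosh x * Real.sin (Real.pi / (1 + b ^ 2)) /
      (Real.sinh x ^ 2 + Real.sin (Real.pi / (1 + b ^ 2)) ^ 2)) := funext (tbaKernel_eq b)
  rw [e]
  refine continuous_const.mul (Continuous.div (by fun_prop) (by fun_prop) fun x => ?_)
  positivity

/-- The kernel has the explicit primitive `2 arctan (sinh x / sin (π / (1 + b²)))`. -/
theorem hasDerivAt_tbaKernel_primitive {b : ℝ} (hb : 0 < b) (x : ℝ) :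
    HasDerivAt (fun x => 2 * Real.arctan (Real.sinh x / Real.sin (Real.pi / (1 + b ^ 2))))
      (tbaKernel b x) x := by
  have h := sin_pi_div_one_add_sq_pos hb
  have := (((Real.hasDerivAt_sinh x).div_const
    (Real.sin (Real.pi / (1 + b ^ 2)))).arctan).const_mul 2
  refine this.congr_deriv ?_
  rw [tbaKernel_eq]
  field_simp
  ring

theorem tendsto_tbaKernel_primitive_atTop {b : ℝ} (hb : 0 < b) :
    Tendsto (fun x => 2 * Real.arctan (Real.sinh x / Real.sin (Real.pi / (1 + b ^ 2))))
      atTop (𝓝 Real.pi) := by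
  have h := sin_pi_div_one_add_sq_pos hb
  have hs : Tendsto Real.sinh atTop atTop := by
    refine tendsto_atTop_mono' _ ?_ tendsto_id
    filter_upwards [eventually_ge_atTop 0] with x hx using Real.self_le_sinh_iff.2 hx
  have := ((Real.tendsto_arctan_atTop.mono_right nhdsWithin_le_nhds).comp
    (hs.atTop_div_const h)).const_mul 2
  simpa [mul_div_cancel₀] using this

theorem tendsto_tbaKernel_primitive_atBot {b : ℝ} (hb : 0 < b) :
    Tendsto (fun x => 2 * Real.arctan (Real.sinh x / Real.sin (Real.pi / (1 + b ^ 2))))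
      atBot (𝓝 (-Real.pi)) := by
  have h := ((tendsto_tbaKernel_primitive_atTop hb).comp tendsto_neg_atBot_atTop).neg
  refine h.congr fun x => ?_
  simp [Real.sinh_neg, neg_div, Real.arctan_neg]

theorem integrable_tbaKernel {b : ℝ} (hb : 0 < b) : Integrable (tbaKernel b) := by
  have hc := continuous_tbaKernel hb
  refine integrable_of_intervalIntegral_norm_tendsto (Real.pi - -Real.pi)
    (a := fun i : ℝ => -i) (b := id) (l := atTop)
    (fun i => hc.integrableOn_Ioc) tendsto_neg_atTop_atBot tendsto_id ?_
  have : ∀ i : ℝ, ∫ x in -i..id i, ‖tbaKernel b x‖ =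
      2 * Real.arctan (Real.sinh i / Real.sin (Real.pi / (1 + b ^ 2))) -
      2 * Real.arctan (Real.sinh (-i) / Real.sin (Real.pi / (1 + b ^ 2))) := fun i => by
    simp_rw [Real.norm_eq_abs, abs_of_nonneg (tbaKernel_nonneg hb _), id]
    exact intervalIntegral.integral_eq_sub_of_hasDerivAt
      (fun x _ => hasDerivAt_tbaKernel_primitive hb x) (hc.intervalIntegrable _ _)
  simp_rw [this]
  exact (tendsto_tbaKernel_primitive_atTop hb).sub
    ((tendsto_tbaKernel_primitive_atBot hb).comp tendsto_neg_atTop_atBot)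

theorem integral_tbaKernel {b : ℝ} (hb : 0 < b) : ∫ x, tbaKernel b x = 2 * Real.pi := by
  rw [integral_of_hasDerivAt_of_tendsto (hasDerivAt_tbaKernel_primitive hb)
    (integrable_tbaKernel hb) (tendsto_tbaKernel_primitive_atBot hb)
    (tendsto_tbaKernel_primitive_atTop hb)]
  ring

theorem integral_tbaKernel_sub {b : ℝ} (hb : 0 < b) (x : ℝ) :
    ∫ y, tbaKernel b (x - y) = 2 * Real.pi := by
  rw [integral_sub_left_eq_self (tbaKernel b) volume x, integral_tbaKernel hb]

/-! ### Existence and uniqueness for the TBA equation -/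

/-- On `[m, ∞)` the function `x ↦ ln (1 + e⁻ˣ)` is Lipschitz with constant `1 / (1 + eᵐ) < 1`. -/
theorem abs_log_one_add_exp_neg_sub_le {m x y : ℝ} (hx : m ≤ x) (hy : m ≤ y) :
    |Real.log (1 + Real.exp (-x)) - Real.log (1 + Real.exp (-y))| ≤
      1 / (1 + Real.exp m) * |x - y| := by
  have hd : ∀ z ∈ Set.Ici m, HasDerivWithinAt (fun z => Real.log (1 + Real.exp (-z)))
      (-(1 / (1 + Real.exp z))) (Set.Ici m) z := fun z _ => by
    have h1 : HasDerivAt (fun z : ℝ => 1 + Real.exp (-z)) (Real.exp (-z) * -1) z :=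
      ((hasDerivAt_neg z).exp).const_add 1
    have h2 := h1.log (by positivity)
    refine (h2.congr_deriv ?_).hasDerivWithinAt
    rw [Real.exp_neg]
    field_simp
    ring
  have := (convex_Ici m).norm_image_sub_le_of_norm_hasDerivWithin_le
    (C := 1 / (1 + Real.exp m)) hd (fun z hz => ?_) hy hx
  · simpa [Real.norm_eq_abs] using this
  · rw [norm_neg, Real.norm_of_nonneg (by positivity)]
    have : Real.exp m ≤ Real.exp z := Real.exp_le_exp.2 hz
    gcongr

theorem log_one_add_exp_neg_nonneg (x : ℝ) : 0 ≤ Real.log (1 + Real.exp (-x)) :=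
  Real.log_nonneg (by linarith [Real.exp_pos (-x)])

theorem log_one_add_exp_neg_le (x : ℝ) : Real.log (1 + Real.exp (-x)) ≤ Real.exp (-x) := by
  have := Real.log_le_sub_one_of_pos (x := 1 + Real.exp (-x)) (by positivity)
  linarith

theorem measurable_log_one_add_exp_neg {f : ℝ → ℝ} (hf : Measurable f) :
    Measurable fun y => Real.log (1 + Real.exp (-f y)) := by fun_prop

theorem integrable_tbaKernel_mul {b : ℝ} (hb : 0 < b) (x : ℝ) {h : ℝ → ℝ} {B : ℝ}
    (hm : Measurable h) (hB : ∀ y, |h y| ≤ B) :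
    Integrable fun y => tbaKernel b (x - y) * h y :=
  ((integrable_tbaKernel hb).comp_sub_left x).mul_bdd (c := B) hm.aestronglyMeasurable
    (Eventually.of_forall hB)

theorem abs_integral_tbaKernel_mul_le {b : ℝ} (hb : 0 < b) (x : ℝ) {h : ℝ → ℝ} {B : ℝ}
    (hB : ∀ y, |h y| ≤ B) :
    |∫ y, tbaKernel b (x - y) * h y| ≤ 2 * Real.pi * B := by
  rw [← integral_tbaKernel_sub hb x, ← integral_mul_const]
  refine norm_integral_le_of_norm_le (G := ℝ)
    (((integrable_tbaKernel hb).comp_sub_left x).mul_const B) (Eventually.of_forall fun y => ?_)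
  rw [norm_mul, Real.norm_of_nonneg (tbaKernel_nonneg hb _)]
  exact mul_le_mul_of_nonneg_left (hB y) (tbaKernel_nonneg hb _)

theorem le_tbaDriving {b r : ℝ} (hb : 0 < b) (hr : 0 ≤ r) (x : ℝ) :
    2 * r * Real.sin (Real.pi / (1 + b ^ 2)) ≤ tbaDriving b r x := by
  have h := sin_pi_div_one_add_sq_pos hb
  exact le_mul_of_one_le_right (by positivity) (Real.one_le_cosh x)

/-- The difference of two solutions is contracted by the equation: if both solutions are at least
`m`, a bound `M` for their difference improves to `|κ| 2π / (1 + eᵐ) * M`. -/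
theorem IsTBASolution.abs_sub_le {κ b r : ℝ} (hb : 0 < b) {ε₁ ε₂ : ℝ → ℝ}
    (h₁ : IsTBASolution κ b r ε₁) (h₂ : IsTBASolution κ b r ε₂) {m M : ℝ}
    (hm₁ : ∀ x, m ≤ ε₁ x) (hm₂ : ∀ x, m ≤ ε₂ x) (hM : ∀ x, |ε₁ x - ε₂ x| ≤ M) (x : ℝ) :
    |ε₁ x - ε₂ x| ≤ |κ| * (2 * Real.pi) / (1 + Real.exp m) * M := by
  have hbd : ∀ {ε : ℝ → ℝ}, (∀ x, m ≤ ε x) → ∀ y, |Real.log (1 + Real.exp (-ε y))| ≤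
      Real.exp (-m) := fun h y => by
    rw [abs_of_nonneg (log_one_add_exp_neg_nonneg _)]
    exact (log_one_add_exp_neg_le _).trans (Real.exp_le_exp.2 (neg_le_neg (h y)))
  have i₁ := integrable_tbaKernel_mul hb x (measurable_log_one_add_exp_neg h₁.measurable) (hbd hm₁)
  have i₂ := integrable_tbaKernel_mul hb x (measurable_log_one_add_exp_neg h₂.measurable) (hbd hm₂)
  have e : ε₁ x - ε₂ x = κ * ∫ y, tbaKernel b (x - y) *
      (Real.log (1 + Real.exp (-ε₁ y)) - Real.log (1 + Real.exp (-ε₂ y))) := by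
    simp_rw [mul_sub]
    rw [integral_sub i₁ i₂, h₁.equation x, h₂.equation x]
    ring
  rw [e, abs_mul]
  have := abs_integral_tbaKernel_mul_le hb x (B := 1 / (1 + Real.exp m) * M)
    (h := fun y => Real.log (1 + Real.exp (-ε₁ y)) - Real.log (1 + Real.exp (-ε₂ y))) fun y =>
      (abs_log_one_add_exp_neg_sub_le (hm₁ y) (hm₂ y)).trans
        (mul_le_mul_of_nonneg_left (hM y) (by positivity))
  calc _ ≤ |κ| * (2 * Real.pi * (1 / (1 + Real.exp m) * M)) := by gcongr
    _ = _ := by ring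

theorem IsTBASolution.eq_of_contracting {κ b r : ℝ} (hb : 0 < b) {ε₁ ε₂ : ℝ → ℝ}
    (h₁ : IsTBASolution κ b r ε₁) (h₂ : IsTBASolution κ b r ε₂) {m : ℝ}
    (hm₁ : ∀ x, m ≤ ε₁ x) (hm₂ : ∀ x, m ≤ ε₂ x)
    (hq : |κ| * (2 * Real.pi) / (1 + Real.exp m) < 1) : ε₁ = ε₂ := by
  obtain ⟨C₁, hC₁⟩ := h₁.bounded
  obtain ⟨C₂, hC₂⟩ := h₂.bounded
  set q := |κ| * (2 * Real.pi) / (1 + Real.exp m) with hqdef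
  have hq0 : 0 ≤ q := by positivity
  have hn : ∀ n : ℕ, ∀ x, |ε₁ x - ε₂ x| ≤ q ^ n * (C₁ + C₂) := fun n => by
    induction n with
    | zero =>
      intro x
      have e : ε₁ x - ε₂ x = (ε₁ x - tbaDriving b r x) - (ε₂ x - tbaDriving b r x) := by ring
      rw [e, pow_zero, one_mul]
      exact (abs_sub _ _).trans (add_le_add (hC₁ x) (hC₂ x))
    | succ n ih =>
      intro x
      have := h₁.abs_sub_le hb h₂ hm₁ hm₂ ih x
      rwa [← hqdef, ← mul_assoc, ← pow_succ'] at this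
  funext x
  have hl : Tendsto (fun n : ℕ => q ^ n * (C₁ + C₂)) atTop (𝓝 (0 * (C₁ + C₂))) :=
    (tendsto_pow_atTop_nhds_zero_of_lt_one hq0 hq).mul_const _
  rw [zero_mul] at hl
  have h0 : |ε₁ x - ε₂ x| ≤ 0 := ge_of_tendsto' hl fun n => hn n x
  exact sub_eq_zero.1 (abs_nonpos_iff.1 h0)

/-- The threshold `1 + 4π|κ| ≤ 2 r sin (π / (1 + b²))` makes the integral operator of the TBA
equation a contraction. -/
theorem abs_mul_two_pi_mul_exp_le_half {κ D : ℝ} (hD : 1 + 4 * Real.pi * |κ| ≤ D) :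
    |κ| * (2 * Real.pi) * Real.exp (-(D - 1)) ≤ 1 / 2 := by
  have h1 : D - 1 + 1 ≤ Real.exp (D - 1) := Real.add_one_le_exp _
  rw [Real.exp_neg, ← div_eq_mul_inv, div_le_iff₀ (Real.exp_pos _)]
  linarith

/-- For `κ < 0` the bound `|κ| ∫ K ≤ 1` closes the contraction for every pair of solutions, while
for `κ ≥ 0` every solution lies above the driving term. -/
theorem IsTBASolution.unique {κ b r : ℝ} (hκ : -(1 / (2 * Real.pi)) ≤ κ) (hb : 0 < b)
    (hr : 0 ≤ r) (hD : 1 + 4 * Real.pi * |κ| ≤ 2 * r * Real.sin (Real.pi / (1 + b ^ 2)))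
    {ε₁ ε₂ : ℝ → ℝ} (h₁ : IsTBASolution κ b r ε₁) (h₂ : IsTBASolution κ b r ε₂) : ε₁ = ε₂ := by
  set D := 2 * r * Real.sin (Real.pi / (1 + b ^ 2)) with hDdef
  rcases le_or_gt 0 κ with h | h
  · have low : ∀ {ε : ℝ → ℝ}, IsTBASolution κ b r ε → ∀ x, D ≤ ε x := fun {ε} hε x => by
      rw [hε.equation x]
      have : 0 ≤ κ * ∫ y, tbaKernel b (x - y) * Real.log (1 + Real.exp (-ε y)) :=
        mul_nonneg h (integral_nonneg fun y =>
          mul_nonneg (tbaKernel_nonneg hb _) (log_one_add_exp_neg_nonneg _))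
      linarith [le_tbaDriving hb hr x]
    refine h₁.eq_of_contracting hb h₂ (low h₁) (low h₂) ?_
    rw [div_lt_one (by positivity)]
    nlinarith [Real.add_one_le_exp D, Real.pi_pos, mul_nonneg Real.pi_pos.le (abs_nonneg κ)]
  · obtain ⟨C₁, hC₁⟩ := h₁.bounded
    obtain ⟨C₂, hC₂⟩ := h₂.bounded
    refine h₁.eq_of_contracting hb h₂ (m := D - max C₁ C₂) (fun x => ?_) (fun x => ?_) ?_
    · linarith [(abs_le.1 (hC₁ x)).1, le_tbaDriving hb hr x, le_max_left C₁ C₂]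
    · linarith [(abs_le.1 (hC₂ x)).1, le_tbaDriving hb hr x, le_max_right C₁ C₂]
    · rw [div_lt_one (by positivity), abs_of_neg h]
      have h3 : -κ * (2 * Real.pi) ≤ 1 := by
        rw [← le_div_iff₀ (by positivity)]
        exact neg_le.1 hκ
      linarith [Real.exp_pos (D - max C₁ C₂)]

/-- Existence, with the bound `|ε - driving term| ≤ 1`: the equation for the deviation `u` from
the driving term is a contraction of the unit ball of bounded continuous functions. -/
theorem exists_isTBASolution {κ b r : ℝ} (hb : 0 < b)
    (hr : 0 ≤ r) (hD : 1 + 4 * Real.pi * |κ| ≤ 2 * r * Real.sin (Real.pi / (1 + b ^ 2))) :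
    ∃ ε, IsTBASolution κ b r ε ∧ ∀ x, |ε x - tbaDriving b r x| ≤ 1 := by
  set D := 2 * r * Real.sin (Real.pi / (1 + b ^ 2)) with hDdef
  have hhalf := abs_mul_two_pi_mul_exp_le_half hD
  have hdc : Continuous (tbaDriving b r) := by unfold tbaDriving; fun_prop
  let F : BoundedContinuousFunction ℝ ℝ → ℝ → ℝ := fun u y =>
    Real.log (1 + Real.exp (-(tbaDriving b r y + u y)))
  have hFc : ∀ u, Continuous (F u) := fun u => by
    refine Continuous.log (by fun_prop) fun y => ?_
    positivity
  let S : Set (BoundedContinuousFunction ℝ ℝ) := Metric.closedBall 0 1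
  have hlow : ∀ u ∈ S, ∀ y, D - 1 ≤ tbaDriving b r y + u y := fun u hu y => by
    have h1 : ‖u y‖ ≤ 1 := (u.norm_coe_le_norm y).trans (by simpa [S] using hu)
    linarith [(abs_le.1 h1).1, le_tbaDriving hb hr y]
  have hFb : ∀ u, ∃ B, ∀ y, |F u y| ≤ B := fun u => ⟨Real.exp (-(D - ‖u‖)), fun y => by
    rw [abs_of_nonneg (log_one_add_exp_neg_nonneg _)]
    refine (log_one_add_exp_neg_le _).trans (Real.exp_le_exp.2 (neg_le_neg ?_))
    linarith [(abs_le.1 (u.norm_coe_le_norm y)).1, le_tbaDriving hb hr y]⟩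
  have hcont : ∀ u, Continuous fun x => κ * ∫ y, tbaKernel b (x - y) * F u y := fun u => by
    obtain ⟨B, hB⟩ := hFb u
    have h1 := BddAbove.continuous_convolution_left_of_integrable (ContinuousLinearMap.mul ℝ ℝ)
      (μ := volume) (f := F u) (g := tbaKernel b) ⟨B, by rintro _ ⟨y, rfl⟩; exact hB y⟩
      (hFc u) (integrable_tbaKernel hb)
    refine continuous_const.mul (h1.congr fun x => ?_)
    simp only [convolution, ContinuousLinearMap.mul_apply']
    exact integral_congr_ae (Eventually.of_forall fun y => mul_comm _ _)
  have hbdd : ∀ u x, ‖κ * ∫ y, tbaKernel b (x - y) * F u y‖ ≤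
      |κ| * (2 * Real.pi * (hFb u).choose) := fun u x => by
    rw [norm_mul]
    exact mul_le_mul_of_nonneg_left (abs_integral_tbaKernel_mul_le hb x (hFb u).choose_spec)
      (abs_nonneg κ)
  let T : BoundedContinuousFunction ℝ ℝ → BoundedContinuousFunction ℝ ℝ := fun u =>
    BoundedContinuousFunction.ofNormedAddCommGroup _ (hcont u) _ (hbdd u)
  have hTapp : ∀ u x, T u x = κ * ∫ y, tbaKernel b (x - y) * F u y := fun u x => rfl
  have hmaps : Set.MapsTo T S S := fun u hu => by
    simp only [S, mem_closedBall_zero_iff]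
    refine (BoundedContinuousFunction.norm_le zero_le_one).2 fun x => ?_
    rw [hTapp, norm_mul]
    have := abs_integral_tbaKernel_mul_le hb x (h := F u) (B := Real.exp (-(D - 1))) fun y => by
      rw [abs_of_nonneg (log_one_add_exp_neg_nonneg _)]
      exact (log_one_add_exp_neg_le _).trans (Real.exp_le_exp.2 (neg_le_neg (hlow u hu y)))
    calc ‖κ‖ * ‖∫ y, tbaKernel b (x - y) * F u y‖
        ≤ |κ| * (2 * Real.pi * Real.exp (-(D - 1))) :=
          mul_le_mul_of_nonneg_left this (abs_nonneg κ)
      _ = |κ| * (2 * Real.pi) * Real.exp (-(D - 1)) := by ring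
      _ ≤ 1 := by linarith
  have hlip : ∀ u ∈ S, ∀ v ∈ S, dist (T u) (T v) ≤ 1 / 2 * dist u v := fun u hu v hv => by
    refine (BoundedContinuousFunction.dist_le (by positivity)).2 fun x => ?_
    obtain ⟨B₁, hB₁⟩ := hFb u
    obtain ⟨B₂, hB₂⟩ := hFb v
    have hl : ∀ y, |F u y - F v y| ≤ Real.exp (-(D - 1)) * dist u v := fun y => by
      refine (abs_log_one_add_exp_neg_sub_le (hlow u hu y) (hlow v hv y)).trans ?_
      have h1 : |tbaDriving b r y + u y - (tbaDriving b r y + v y)| ≤ dist u v := by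
        rw [add_sub_add_left_eq_sub]
        exact u.dist_coe_le_dist (g := v) y
      have h2 : 1 / (1 + Real.exp (D - 1)) ≤ Real.exp (-(D - 1)) := by
        rw [Real.exp_neg, ← one_div]
        gcongr
        linarith
      gcongr
    have h3 := abs_integral_tbaKernel_mul_le hb x hl
    rw [Real.dist_eq, hTapp, hTapp, ← mul_sub, ← integral_sub
      (integrable_tbaKernel_mul hb x (hFc u).measurable hB₁)
      (integrable_tbaKernel_mul hb x (hFc v).measurable hB₂), abs_mul]
    simp_rw [← mul_sub]
    calc _ ≤ |κ| * (2 * Real.pi * (Real.exp (-(D - 1)) * dist u v)) :=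
          mul_le_mul_of_nonneg_left h3 (abs_nonneg κ)
      _ = |κ| * (2 * Real.pi) * Real.exp (-(D - 1)) * dist u v := by ring
      _ ≤ _ := mul_le_mul_of_nonneg_right hhalf dist_nonneg
  have hcontr : ContractingWith (1 / 2) (hmaps.restrict T S S) := by
    refine ⟨by norm_num, LipschitzWith.of_dist_le_mul fun u v => ?_⟩
    have := hlip u u.2 v v.2
    rw [Subtype.dist_eq, Subtype.dist_eq]
    exact_mod_cast this
  obtain ⟨u, huS, hu, -⟩ := hcontr.exists_fixedPoint' Metric.isClosed_closedBall.isComplete hmaps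
    (x := 0) (by simp [S]) (edist_ne_top _ _)
  have hux : ∀ x, |u x| ≤ 1 := fun x => (u.norm_coe_le_norm x).trans (by simpa [S] using huS)
  refine ⟨fun x => tbaDriving b r x + u x, ⟨(hdc.add u.continuous).measurable, ⟨1, ?_⟩, ?_⟩, ?_⟩
  · intro x; simpa using hux x
  · intro x
    have := hTapp u x
    rw [hu] at this
    rw [this]
  · intro x; simpa using hux x

/-! ### Strong convexity of the potential -/

theorem convexOn_univ_of_hasDerivAt2_nonneg {f f' f'' : ℝ → ℝ} (h1 : ∀ x, HasDerivAt f (f' x) x)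
    (h2 : ∀ x, HasDerivAt f' (f'' x) x) (h0 : ∀ x, 0 ≤ f'' x) : ConvexOn ℝ Set.univ f := by
  have e : deriv f = f' := funext fun x => (h1 x).deriv
  refine MonotoneOn.convexOn_of_deriv convex_univ
    (fun x _ => (h1 x).continuousAt.continuousWithinAt)
    (fun x _ => (h1 x).differentiableAt.differentiableWithinAt) ?_
  rw [e]
  exact (monotone_of_deriv_nonneg (fun x => (h2 x).differentiableAt) fun x => by
    rw [(h2 x).deriv]; exact h0 x).monotoneOn _

theorem convexOn_sq_half_sub_inv_cosh :
    ConvexOn ℝ Set.univ fun u : ℝ => u ^ 2 / 2 - 1 / Real.cosh u := by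
  refine convexOn_univ_of_hasDerivAt2_nonneg (f' := fun u => u + Real.sinh u / Real.cosh u ^ 2)
    (f'' := fun u => 1 + (2 - Real.cosh u ^ 2) / Real.cosh u ^ 3) (fun u => ?_) (fun u => ?_)
    fun u => ?_
  · have hc := (Real.cosh_pos u).ne'
    have h := (((hasDerivAt_id u).pow 2).div_const 2).sub
      ((hasDerivAt_const u (1 : ℝ)).div (Real.hasDerivAt_cosh u) hc)
    refine h.congr_deriv ?_
    simp
    field_simp
    ring
  · have hc := (Real.cosh_pos u).ne'
    have h := (hasDerivAt_id u).add ((Real.hasDerivAt_sinh u).div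
      ((Real.hasDerivAt_cosh u).pow 2) (pow_ne_zero 2 hc))
    refine h.congr_deriv ?_
    have := Real.cosh_sq u
    simp
    field_simp
    rw [show Real.sinh u ^ 2 = Real.cosh u ^ 2 - 1 by linarith]
    ring
  · have h1 := Real.one_le_cosh u
    have h2 := Real.cosh_pos u
    rw [← div_self (pow_ne_zero 3 h2.ne'), ← add_div]
    refine div_nonneg ?_ (by positivity)
    nlinarith [mul_nonneg (sq_nonneg (Real.cosh u)) (sub_nonneg.2 h1)]

theorem convexOn_cosh_sub_sq_half :
    ConvexOn ℝ Set.univ fun u : ℝ => Real.cosh u - u ^ 2 / 2 := by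
  refine convexOn_univ_of_hasDerivAt2_nonneg (f' := fun u => Real.sinh u - u)
    (f'' := fun u => Real.cosh u - 1) (fun u => ?_) (fun u => ?_)
    fun u => sub_nonneg.2 (Real.one_le_cosh u)
  · refine ((Real.hasDerivAt_cosh u).sub (((hasDerivAt_id u).pow 2).div_const 2)).congr_deriv ?_
    simp
  · exact (Real.hasDerivAt_sinh u).sub (hasDerivAt_id u)

theorem ConvexOn.comp_mul_sub {f : ℝ → ℝ} (hf : ConvexOn ℝ Set.univ f) (τ y : ℝ) :
    ConvexOn ℝ Set.univ fun x => f (τ * (x - y)) := by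
  refine ⟨convex_univ, fun x _ z _ a b ha hb hab => ?_⟩
  have := hf.2 (Set.mem_univ (τ * (x - y))) (Set.mem_univ (τ * (z - y))) ha hb hab
  have e : τ * (a • x + b • z - y) = a • (τ * (x - y)) + b • (τ * (z - y)) := by
    simp only [smul_eq_mul]
    linear_combination τ * y * hab
  rwa [← e] at this

theorem ConvexOn.integral_fun {h : ℝ → ℝ → ℝ} (hc : ∀ y, ConvexOn ℝ Set.univ fun x => h x y)
    (hi : ∀ x, Integrable (h x)) : ConvexOn ℝ Set.univ fun x => ∫ y, h x y := by
  refine ⟨convex_univ, fun x _ z _ a b ha hb hab => ?_⟩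
  simp only [smul_eq_mul]
  rw [← integral_const_mul, ← integral_const_mul,
    ← integral_add ((hi x).const_mul a) ((hi z).const_mul b)]
  exact integral_mono (hi _) (((hi x).const_mul a).add ((hi z).const_mul b))
    fun y => (hc y).2 (Set.mem_univ x) (Set.mem_univ z) ha hb hab

theorem convexOn_linear (c : ℝ) : ConvexOn ℝ Set.univ fun x : ℝ => c * x :=
  ⟨convex_univ, fun x _ z _ a b _ _ _ => by simp only [smul_eq_mul]; linarith⟩

/-- Subtracting `1 / cosh` costs at most the convexity of a quadratic of the same scale, so the
convolution term lowers the convexity modulus `r τ / N` of `r / (N τ) cosh (τ x)` by at most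
`(∫ g) τ / (2 π N)`. -/
theorem strongConvexOn_potential {ε : ℝ → ℝ} {r α : ℝ} {N : ℕ} (hN : 2 ≤ N) (hr : 0 ≤ r)
    (hg0 : ∀ x, 0 ≤ tbaG ε x) (hg : Integrable (tbaG ε)) :
    StrongConvexOn Set.univ (tauN N / N * (r - (∫ x, tbaG ε x) / (2 * Real.pi)))
      (potential ε r α N) := by
  have hτ : 0 < tauN N := Real.log_pos (by exact_mod_cast hN)
  have hn : (0 : ℝ) < N := by exact_mod_cast (by omega : 0 < N)
  set τ := tauN N with hτdef
  set n : ℝ := (N : ℝ) with hndef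
  rw [strongConvexOn_iff_convex]
  let w : ℝ → ℝ := fun y => 1 / (2 * Real.pi * n) * tbaG ε (τ * y)
  have hw0 : ∀ y, 0 ≤ w y := fun y => mul_nonneg (by positivity) (hg0 _)
  have hwi : Integrable w := (hg.comp_mul_left' hτ.ne').const_mul _
  have hwint : ∫ y, w y = 1 / (2 * Real.pi * n) * (τ⁻¹ * ∫ x, tbaG ε x) := by
    simp only [w]
    rw [integral_const_mul, Measure.integral_comp_mul_left, abs_of_pos (inv_pos.2 hτ), smul_eq_mul]
  have hwc : ∀ x, Integrable fun y => w y * (1 / Real.cosh (τ * (x - y))) := fun x => by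
    refine hwi.mul_bdd (c := 1) ?_ (Eventually.of_forall fun y => ?_)
    · refine Continuous.aestronglyMeasurable (Continuous.div (by fun_prop) (by fun_prop) ?_)
      exact fun y => (Real.cosh_pos _).ne'
    · rw [Real.norm_of_nonneg (one_div_nonneg.2 (Real.cosh_pos _).le)]
      exact (div_le_one (Real.cosh_pos _)).2 (Real.one_le_cosh _)
  have hK : ConvexOn ℝ Set.univ fun x => ∫ y, (w y * ((τ * x) ^ 2 / 2) -
      w y * (1 / Real.cosh (τ * (x - y)))) := by
    refine ConvexOn.integral_fun (fun y => ?_) fun x => (hwi.mul_const _).sub (hwc x)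
    have h1 := ((convexOn_sq_half_sub_inv_cosh.comp_mul_sub τ y).smul (hw0 y)).add
      ((convexOn_linear (w y * τ ^ 2 * y)).add (convexOn_const (-(w y * τ ^ 2 * y ^ 2 / 2))
        convex_univ))
    refine h1.congr fun x _ => ?_
    simp only [Pi.add_apply, smul_eq_mul]
    ring
  have hC : ConvexOn ℝ Set.univ fun x => r / (n * τ) * (Real.cosh (τ * x) - (τ * x) ^ 2 / 2) := by
    have := (convexOn_cosh_sub_sq_half.comp_mul_sub τ 0).smul (c := r / (n * τ)) (by positivity)
    simpa using this
  refine ((hC.add (convexOn_linear (-α / n))).add hK).congr fun x _ => ?_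
  simp only [Pi.add_apply]
  rw [integral_sub (hwi.mul_const _) (hwc x), integral_mul_const, hwint]
  have : ∫ y, 1 / (2 * Real.pi * n) * (tbaG ε (τ * y) / Real.cosh (τ * (x - y))) =
      ∫ y, w y * (1 / Real.cosh (τ * (x - y))) :=
    integral_congr_ae (Eventually.of_forall fun y => by simp only [w]; ring)
  rw [potential, ← hτdef, ← hndef, this, Real.norm_eq_abs, sq_abs]
  field_simp
  ring

theorem tbaG_nonneg (ε : ℝ → ℝ) (x : ℝ) : 0 ≤ tbaG ε x :=
  mul_nonneg zero_le_two (log_one_add_exp_neg_nonneg _)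

theorem exp_neg_cosh_le (v : ℝ) : Real.exp (-Real.cosh v) ≤ 2 * (1 + v ^ 2)⁻¹ := by
  have h1 := Real.quadratic_le_exp_of_nonneg (Real.cosh_pos v).le
  have h2 : v ^ 2 ≤ Real.sinh v ^ 2 := by
    rw [← sq_abs v, ← sq_abs (Real.sinh v), Real.abs_sinh]
    exact pow_le_pow_left₀ (abs_nonneg v) (Real.self_le_sinh_iff.2 (abs_nonneg v)) 2
  rw [Real.exp_neg, ← div_eq_mul_inv, ← one_div, div_le_div_iff₀ (Real.exp_pos _) (by positivity)]
  nlinarith [Real.cosh_sq v, Real.one_le_cosh v]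

/-- If `ε` stays within distance `1` of a driving term `D cosh` with `D ≥ 1`, then `g` is
dominated by a fixed Cauchy density. -/
theorem tbaG_le {b r : ℝ} (hD : 1 ≤ 2 * r * Real.sin (Real.pi / (1 + b ^ 2))) {ε : ℝ → ℝ}
    (hε : ∀ x, |ε x - tbaDriving b r x| ≤ 1) (v : ℝ) :
    tbaG ε v ≤ 4 * Real.exp 1 * (1 + v ^ 2)⁻¹ := by
  have h1 : Real.cosh v ≤ tbaDriving b r v := le_mul_of_one_le_left (Real.cosh_pos v).le hD
  have h2 : Real.exp (-ε v) ≤ Real.exp 1 * Real.exp (-Real.cosh v) := by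
    rw [← Real.exp_add]
    exact Real.exp_le_exp.2 (by linarith [(abs_le.1 (hε v)).1])
  calc tbaG ε v ≤ 2 * (Real.exp 1 * Real.exp (-Real.cosh v)) :=
        mul_le_mul_of_nonneg_left ((log_one_add_exp_neg_le _).trans h2) zero_le_two
    _ ≤ 2 * (Real.exp 1 * (2 * (1 + v ^ 2)⁻¹)) := by
        gcongr
        exact exp_neg_cosh_le v
    _ = _ := by ring

theorem integrable_tbaG {b r : ℝ} (hD : 1 ≤ 2 * r * Real.sin (Real.pi / (1 + b ^ 2))) {ε : ℝ → ℝ}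
    (hm : Measurable ε) (hε : ∀ x, |ε x - tbaDriving b r x| ≤ 1) : Integrable (tbaG ε) := by
  refine (integrable_inv_one_add_sq.const_mul (4 * Real.exp 1)).mono'
    ((measurable_log_one_add_exp_neg hm).const_mul 2).aestronglyMeasurable
    (Eventually.of_forall fun v => ?_)
  rw [Real.norm_of_nonneg (tbaG_nonneg ε v)]
  exact tbaG_le hD hε v

theorem integral_tbaG_lt {b r : ℝ} (hD : 1 ≤ 2 * r * Real.sin (Real.pi / (1 + b ^ 2))) {ε : ℝ → ℝ}
    (hm : Measurable ε) (hε : ∀ x, |ε x - tbaDriving b r x| ≤ 1) :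
    (∫ x, tbaG ε x) / (2 * Real.pi) < 6 := by
  have h := integral_mono (integrable_tbaG hD hm hε)
    (integrable_inv_one_add_sq.const_mul (4 * Real.exp 1)) (tbaG_le hD hε)
  rw [integral_const_mul, integral_univ_inv_one_add_sq] at h
  rw [div_lt_iff₀ (by positivity)]
  nlinarith [Real.exp_one_lt_d9, Real.pi_pos]

open Set

/-! ### Quantile functions -/

/-- The uniform distribution on `(0, 1)`. -/
abbrev unitUniform : Measure ℝ := volume.restrict (Ioo 0 1)

instance : IsProbabilityMeasure unitUniform := ⟨by simp⟩

/-- A probability measure on `ℝ` is the law of its quantile function, which is monotone. -/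
theorem exists_monotoneOn_map_unitUniform_eq (μ : Measure ℝ) [IsProbabilityMeasure μ] :
    ∃ Q : ℝ → ℝ, Measurable Q ∧ MonotoneOn Q (Ioo 0 1) ∧ unitUniform.map Q = μ := by
  let F := ProbabilityTheory.cdf μ
  let q : ℝ → ℝ := fun p => sInf {x | p ≤ F x}
  have hne : ∀ p ∈ Ioo (0 : ℝ) 1, {x | p ≤ F x}.Nonempty := fun p hp =>
    (((ProbabilityTheory.tendsto_cdf_atTop μ).eventually (lt_mem_nhds hp.2)).exists).imp
      fun _ h => le_of_lt h
  have hbb : ∀ p ∈ Ioo (0 : ℝ) 1, BddBelow {x | p ≤ F x} := fun p hp => by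
    obtain ⟨a, ha⟩ :=
      ((ProbabilityTheory.tendsto_cdf_atBot μ).eventually (gt_mem_nhds hp.1)).exists
    refine ⟨a, fun x hx => ?_⟩
    by_contra h
    exact absurd (lt_of_le_of_lt (F.mono (not_le.1 h).le) ha) (not_lt.2 hx)
  have gal : ∀ p ∈ Ioo (0 : ℝ) 1, ∀ x, q p ≤ x ↔ p ≤ F x := fun p hp x => by
    refine ⟨fun h => ?_, fun h => csInf_le (hbb p hp) h⟩
    have h1 : ∀ᶠ y in 𝓝[>] x, p ≤ F y := by
      filter_upwards [self_mem_nhdsWithin] with y hy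
      obtain ⟨z, hz, hzy⟩ := exists_lt_of_csInf_lt (hne p hp) (lt_of_le_of_lt h hy)
      exact le_trans hz (F.mono hzy.le)
    exact ge_of_tendsto ((F.right_continuous x).mono Ioi_subset_Ici_self) h1
  let Q := (Ioo (0 : ℝ) 1).indicator q
  have hQ : ∀ p ∈ Ioo (0 : ℝ) 1, Q p = q p := fun p hp => indicator_of_mem hp q
  have hpre : ∀ x, Q ⁻¹' Iic x ∩ Ioo 0 1 = Iic (F x) ∩ Ioo 0 1 := fun x => by
    ext p
    refine and_congr_left fun hp => ?_
    rw [mem_preimage, hQ p hp, mem_Iic, gal p hp, mem_Iic]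
  have hmeas : Measurable Q := by
    refine measurable_of_Iic fun x => ?_
    have h0 : Q ⁻¹' Iic x = (Iic (F x) ∩ Ioo 0 1) ∪ ((Ioo 0 1)ᶜ ∩ {_p | 0 ≤ x}) := by
      rw [← hpre x]
      ext p
      by_cases hp : p ∈ Ioo (0 : ℝ) 1
      · simp [hp]
      · simp [Q, hp]
    rw [h0]
    exact (measurableSet_Iic.inter measurableSet_Ioo).union
      (measurableSet_Ioo.compl.inter (MeasurableSet.const _))
  refine ⟨Q, hmeas, fun p hp p' hp' hpp => ?_, ?_⟩
  · rw [hQ p hp, hQ p' hp', gal p hp]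
    exact hpp.trans ((gal p' hp' _).1 le_rfl)
  · have : IsProbabilityMeasure (unitUniform.map Q) :=
      Measure.isProbabilityMeasure_map hmeas.aemeasurable
    refine Measure.ext_of_Iic _ _ fun x => ?_
    rw [Measure.map_apply hmeas measurableSet_Iic,
      Measure.restrict_apply (hmeas measurableSet_Iic), hpre x, ← ProbabilityTheory.ofReal_cdf μ x]
    have h0 := ProbabilityTheory.cdf_nonneg μ x
    have h1 := ProbabilityTheory.cdf_le_one μ x
    change volume (Iic (F x) ∩ Ioo 0 1) = ENNReal.ofReal (F x)
    refine le_antisymm ?_ ?_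
    · calc volume (Iic (F x) ∩ Ioo 0 1) ≤ volume (Ioc 0 (F x)) :=
            measure_mono fun p hp => ⟨hp.2.1, hp.1⟩
        _ = ENNReal.ofReal (F x) := by rw [Real.volume_Ioc, sub_zero]
    · calc ENNReal.ofReal (F x) = volume (Ioo 0 (F x)) := by rw [Real.volume_Ioo, sub_zero]
        _ ≤ volume (Iic (F x) ∩ Ioo 0 1) :=
            measure_mono fun p hp => ⟨hp.2.le, hp.1, hp.2.trans_le h1⟩

/-! ### Energy minimisation for interactions convex off the diagonal -/

/-- A symmetric, continuous, extended nonnegative two-body energy density on the line that is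
infinite on the diagonal, strongly convex with modulus `2 k` on the closed half plane
`p.1 ≤ p.2`, confining, and integrable on bounded squares. -/
structure ConfiningInteraction (H : ℝ × ℝ → ENNReal) (k : ℝ) : Prop where
  pos : 0 < k
  continuous : Continuous H
  symm : ∀ x y, H (x, y) = H (y, x)
  diag : ∀ x, H (x, x) = ⊤
  convex : ∀ x y x' y' a b : ℝ, x ≤ y → x' ≤ y' → 0 < a → 0 < b → a + b = 1 →
    H (a * x + b * x', a * y + b * y') +
        ENNReal.ofReal (k * (a * b) * ((x - x') ^ 2 + (y - y') ^ 2)) ≤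
      ENNReal.ofReal a * H (x, y) + ENNReal.ofReal b * H (x', y')
  confining : ∀ x y, ENNReal.ofReal (|x| + |y|) ≤ H (x, y)
  lintegral_ne_top : ∀ u v : ℝ, u < v → ∫⁻ x in Ioo u v, ∫⁻ y in Ioo u v, H (x, y) ≠ ⊤

/-- The energy `∬ H dμ dμ`. -/
def pairEnergy (H : ℝ × ℝ → ENNReal) (μ : Measure ℝ) : ENNReal :=
  ∫⁻ p, H p ∂(μ.prod μ)

/-- The effective potential `∫ H(x, y) dμ(y)` generated by `μ`. -/
def effectivePotential (H : ℝ × ℝ → ENNReal) (μ : Measure ℝ) (x : ℝ) : ENNReal :=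
  ∫⁻ y, H (x, y) ∂μ

theorem pairEnergy_map {H : ℝ × ℝ → ENNReal} (hH : Measurable H) {ν : Measure ℝ} [SFinite ν]
    {Q : ℝ → ℝ} (hQ : Measurable Q) :
    pairEnergy H (ν.map Q) = ∫⁻ p, H (Q p.1, Q p.2) ∂(ν.prod ν) := by
  rw [pairEnergy, Measure.map_prod_map ν ν hQ hQ, lintegral_map hH (hQ.prodMap hQ)]
  rfl

namespace ConfiningInteraction

variable {H : ℝ × ℝ → ENNReal} {k : ℝ}

/-- Displacement convexity: the energy is strongly convex along the segment between two monotone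
quantile functions, because pairs of quantiles never cross the diagonal. -/
theorem displacement_convex (h : ConfiningInteraction H k) {Q Q' : ℝ → ℝ} (hQ : Measurable Q)
    (hQ' : Measurable Q') (hm : MonotoneOn Q (Ioo 0 1)) (hm' : MonotoneOn Q' (Ioo 0 1)) :
    2 * pairEnergy H (unitUniform.map fun p => 1 / 2 * Q p + 1 / 2 * Q' p) +
        ENNReal.ofReal (k / 2) * ∫⁻ p, ‖Q p - Q' p‖ₑ ^ 2 ∂unitUniform ≤
      pairEnergy H (unitUniform.map Q) + pairEnergy H (unitUniform.map Q') := by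
  have hHm := h.continuous.measurable
  have hmid : Measurable fun p => 1 / 2 * Q p + 1 / 2 * Q' p := by fun_prop
  have two_half : (2 : ENNReal) * ENNReal.ofReal (1 / 2) = 1 := by
    rw [← ENNReal.ofReal_ofNat 2, ← ENNReal.ofReal_mul (by norm_num)]; norm_num
  have aux : ∀ x y x' y' : ℝ, x ≤ y → x' ≤ y' → ∀ d, d ≤ (x - x') ^ 2 + (y - y') ^ 2 →
      2 * H (1 / 2 * x + 1 / 2 * x', 1 / 2 * y + 1 / 2 * y') + ENNReal.ofReal (k / 2 * d) ≤
        H (x, y) + H (x', y') := by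
    intro x y x' y' hxy hxy' d hd
    have hk := h.pos
    have h1 := mul_le_mul_right (h.convex x y x' y' (1 / 2) (1 / 2) hxy hxy' (by norm_num)
      (by norm_num) (by norm_num)) (2 : ENNReal)
    rw [mul_add 2 (H _), mul_add 2 (ENNReal.ofReal _ * _), ← mul_assoc 2, ← mul_assoc 2, two_half,
      one_mul, one_mul] at h1
    refine le_trans (add_le_add le_rfl ?_) h1
    rw [← ENNReal.ofReal_ofNat 2, ← ENNReal.ofReal_mul (by norm_num)]
    refine ENNReal.ofReal_le_ofReal ?_
    nlinarith
  have hsq : ∫⁻ p, ‖Q p - Q' p‖ₑ ^ 2 ∂unitUniform =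
      ∫⁻ p, ENNReal.ofReal ((Q p.1 - Q' p.1) ^ 2) ∂(unitUniform.prod unitUniform) := by
    rw [lintegral_prod _ (by fun_prop)]
    simp only [lintegral_const, measure_univ, mul_one]
    refine lintegral_congr fun p => ?_
    rw [Real.enorm_eq_ofReal_abs, ← ENNReal.ofReal_pow (abs_nonneg _), sq_abs]
  have hae : ∀ᵐ p ∂(unitUniform.prod unitUniform),
      p.1 ∈ Ioo (0 : ℝ) 1 ∧ p.2 ∈ Ioo (0 : ℝ) 1 := by
    rw [unitUniform, Measure.prod_restrict]
    filter_upwards [ae_restrict_mem (measurableSet_Ioo.prod measurableSet_Ioo)] with p hp using hp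
  rw [pairEnergy_map hHm hmid, pairEnergy_map hHm hQ, pairEnergy_map hHm hQ', hsq,
    ← lintegral_const_mul _ (by fun_prop), ← lintegral_const_mul _ (by fun_prop),
    ← lintegral_add_left (by fun_prop), ← lintegral_add_left (by fun_prop)]
  refine lintegral_mono_ae ?_
  filter_upwards [hae] with p hp
  rw [← ENNReal.ofReal_mul (by linarith [h.pos])]
  rcases le_total p.1 p.2 with hle | hle
  · exact aux _ _ _ _ (hm hp.1 hp.2 hle) (hm' hp.1 hp.2 hle) _
      (le_add_of_nonneg_right (sq_nonneg _))
  · have := aux _ _ _ _ (hm hp.2 hp.1 hle) (hm' hp.2 hp.1 hle) _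
      (le_add_of_nonneg_left (sq_nonneg (Q p.2 - Q' p.2)))
    rwa [h.symm, h.symm (Q p.2), h.symm (Q' p.2)] at this

/-- Two probability measures of minimal finite energy have quantile functions at distance zero. -/
theorem unique_minimiser (h : ConfiningInteraction H k) {μ ν : Measure ℝ}
    [IsProbabilityMeasure μ] [IsProbabilityMeasure ν] (hfin : pairEnergy H μ ≠ ⊤)
    (hμ : ∀ ρ : Measure ℝ, IsProbabilityMeasure ρ → pairEnergy H μ ≤ pairEnergy H ρ)
    (hν : pairEnergy H ν ≤ pairEnergy H μ) : ν = μ := by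
  obtain ⟨Q, hQ, hm, rfl⟩ := exists_monotoneOn_map_unitUniform_eq μ
  obtain ⟨Q', hQ', hm', rfl⟩ := exists_monotoneOn_map_unitUniform_eq ν
  have h1 := h.displacement_convex hQ hQ' hm hm'
  have h2 := hμ (unitUniform.map fun p => 1 / 2 * Q p + 1 / 2 * Q' p)
    (Measure.isProbabilityMeasure_map (by fun_prop))
  have h3 : 2 * pairEnergy H (unitUniform.map Q) +
      ENNReal.ofReal (k / 2) * ∫⁻ p, ‖Q p - Q' p‖ₑ ^ 2 ∂unitUniform ≤
      2 * pairEnergy H (unitUniform.map Q) + 0 := by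
    refine le_trans (add_le_add (mul_le_mul_right h2 2) le_rfl) (h1.trans ?_)
    rw [add_zero, two_mul]
    exact add_le_add le_rfl hν
  have h4 := (ENNReal.add_le_add_iff_left (ENNReal.mul_ne_top (by simp) hfin)).1 h3
  rw [nonpos_iff_eq_zero, mul_eq_zero] at h4
  have h5 := h4.resolve_left (by simpa using h.pos)
  rw [lintegral_eq_zero_iff (by fun_prop)] at h5
  refine Measure.map_congr ?_
  filter_upwards [h5] with p hp
  have : Q p - Q' p = 0 := by simpa using hp
  linarith

/-- The conditional law of `ν` on a set `S` of positive measure has the energy of the restriction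
of `ν` to `S`, up to the normalisation. -/
theorem pairEnergy_cond (h : ConfiningInteraction H k) (ν : Measure ℝ) [SFinite ν] (S : Set ℝ) :
    pairEnergy H (ProbabilityTheory.cond ν S) =
      (ν S)⁻¹ * ((ν S)⁻¹ * ∫⁻ x in S, ∫⁻ y in S, H (x, y) ∂ν ∂ν) := by
  have hHm := h.continuous.measurable
  rw [pairEnergy, ProbabilityTheory.cond]
  by_cases h0 : ν S = 0
  · rw [Measure.restrict_eq_zero.2 h0]; simp
  rw [lintegral_prod _ hHm.aemeasurable]
  simp only [lintegral_smul_measure, smul_eq_mul]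
  rw [lintegral_const_mul _ hHm.lintegral_prod_right']

theorem exists_pairEnergy_ne_top (h : ConfiningInteraction H k) :
    ∃ ν : Measure ℝ, IsProbabilityMeasure ν ∧ pairEnergy H ν ≠ ⊤ := by
  refine ⟨ProbabilityTheory.cond volume (Ioo 0 1),
    ProbabilityTheory.cond_isProbabilityMeasure_of_finite (by simp) (by simp), ?_⟩
  rw [h.pairEnergy_cond]
  simpa using h.lintegral_ne_top 0 1 one_pos

/-- The quantile functions of a minimising sequence are Cauchy in `L²` by displacement convexity;
the law of an almost everywhere limit is a minimiser by Fatou's lemma. -/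
theorem exists_minimiser (h : ConfiningInteraction H k) :
    ∃ μ : Measure ℝ, IsProbabilityMeasure μ ∧ pairEnergy H μ ≠ ⊤ ∧
      ∀ ρ : Measure ℝ, IsProbabilityMeasure ρ → pairEnergy H μ ≤ pairEnergy H ρ := by
  have hk := h.pos
  have hHm := h.continuous.measurable
  set e : ENNReal := ⨅ ρ : ProbabilityMeasure ℝ, pairEnergy H ρ with he
  have hele : ∀ ρ : Measure ℝ, IsProbabilityMeasure ρ → e ≤ pairEnergy H ρ := fun ρ hρ =>
    iInf_le (fun ρ : ProbabilityMeasure ℝ => pairEnergy H ρ) ⟨ρ, hρ⟩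
  have hetop : e ≠ ⊤ := by
    obtain ⟨ν, hν, hνtop⟩ := h.exists_pairEnergy_ne_top
    exact ne_top_of_le_ne_top hνtop (hele ν hν)
  -- An excess energy `k / 8 * 4⁻ⁿ` forces the `L²` distance below `2⁻ⁿ`.
  let δ : ℕ → ENNReal := fun n => ENNReal.ofReal (k / 8 * (1 / 4) ^ n)
  have hδ : ∀ n, 0 < δ n := fun n => ENNReal.ofReal_pos.2 (by positivity)
  have hex : ∀ n, ∃ Q : ℝ → ℝ, Measurable Q ∧ MonotoneOn Q (Ioo 0 1) ∧
      pairEnergy H (unitUniform.map Q) ≤ e + δ n := fun n => by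
    obtain ⟨ρ, hρ⟩ := iInf_lt_iff.1
      (show e < e + δ n from ENNReal.lt_add_right hetop (hδ n).ne')
    obtain ⟨Q, hQ, hm, hmap⟩ := exists_monotoneOn_map_unitUniform_eq (ρ : Measure ℝ)
    exact ⟨Q, hQ, hm, by rw [hmap]; exact hρ.le⟩
  choose Q hQ hmono hQe using hex
  have hcau : ∀ N n m : ℕ, N ≤ n → N ≤ m →
      eLpNorm (Q n - Q m) 2 unitUniform < ENNReal.ofReal ((1 / 2) ^ N) := by
    intro N n m hn hm
    have hδle : ∀ n, N ≤ n → δ n ≤ δ N := fun n hn => ENNReal.ofReal_le_ofReal <|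
      mul_le_mul_of_nonneg_left (pow_le_pow_of_le_one (by norm_num) (by norm_num) hn)
        (by positivity)
    have h1 := h.displacement_convex (hQ n) (hQ m) (hmono n) (hmono m)
    have h2 := hele (unitUniform.map fun p => 1 / 2 * Q n p + 1 / 2 * Q m p)
      (Measure.isProbabilityMeasure_map (by have := hQ n; have := hQ m; fun_prop))
    have h3 : 2 * e + ENNReal.ofReal (k / 2) * ∫⁻ p, ‖Q n p - Q m p‖ₑ ^ 2 ∂unitUniform ≤
        2 * e + 2 * δ N := by
      refine le_trans (add_le_add (mul_le_mul_right h2 2) le_rfl) (h1.trans ?_)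
      calc _ ≤ (e + δ N) + (e + δ N) :=
            add_le_add ((hQe n).trans (add_le_add le_rfl (hδle n hn)))
              ((hQe m).trans (add_le_add le_rfl (hδle m hm)))
        _ = 2 * e + 2 * δ N := by ring
    have h4 := (ENNReal.add_le_add_iff_left (ENNReal.mul_ne_top (by simp) hetop)).1 h3
    have h5 : (2 : ENNReal) * δ N =
        ENNReal.ofReal (k / 2) * ENNReal.ofReal (1 / 2 * (1 / 4) ^ N) := by
      rw [← ENNReal.ofReal_mul (by positivity), ← ENNReal.ofReal_ofNat 2,
        ← ENNReal.ofReal_mul (by norm_num)]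
      congr 1; ring
    rw [h5, ENNReal.mul_le_mul_iff_right (by simpa using hk) (by simp)] at h4
    rw [eLpNorm_eq_lintegral_rpow_enorm_toReal (by simp) (by simp)]
    simp only [ENNReal.toReal_ofNat, Pi.sub_apply, ENNReal.rpow_ofNat]
    have h6 : ENNReal.ofReal ((1 / 2) ^ N) = (ENNReal.ofReal ((1 / 4) ^ N)) ^ (1 / 2 : ℝ) := by
      rw [ENNReal.ofReal_rpow_of_nonneg (by positivity) (by norm_num), ← Real.sqrt_eq_rpow,
        show (1 / 4 : ℝ) ^ N = ((1 / 2) ^ N) ^ 2 by rw [← pow_mul, mul_comm, pow_mul]; norm_num,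
        Real.sqrt_sq (by positivity)]
    rw [h6]
    refine ENNReal.rpow_lt_rpow (lt_of_le_of_lt h4 ?_) (by norm_num)
    rw [ENNReal.ofReal_lt_ofReal_iff (by positivity)]
    have : (0 : ℝ) < (1 / 4) ^ N := by positivity
    linarith
  have hsum : ∑' n, ENNReal.ofReal ((1 / 2 : ℝ) ^ n) ≠ ⊤ :=
    Summable.tsum_ofReal_ne_top (summable_geometric_of_lt_one (by norm_num) (by norm_num))
  have hlim := Lp.ae_tendsto_of_cauchy_eLpNorm (fun n => (hQ n).aestronglyMeasurable)
    (by norm_num) hsum hcau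
  obtain ⟨q, hq, hqlim⟩ := measurable_limit_of_tendsto_metrizable_ae
    (fun n => (hQ n).aemeasurable) hlim
  have hprob : IsProbabilityMeasure (unitUniform.map q) :=
    Measure.isProbabilityMeasure_map hq.aemeasurable
  have hfatou : pairEnergy H (unitUniform.map q) ≤ e := by
    have hae : ∀ᵐ p ∂(unitUniform.prod unitUniform),
        H (q p.1, q p.2) = liminf (fun n => H (Q n p.1, Q n p.2)) atTop := by
      filter_upwards [Measure.quasiMeasurePreserving_fst.ae hqlim,
        Measure.quasiMeasurePreserving_snd.ae hqlim] with p hp1 hp2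
      exact (((h.continuous.tendsto _).comp (hp1.prodMk_nhds hp2)).liminf_eq).symm
    rw [pairEnergy_map hHm hq, lintegral_congr_ae hae]
    refine (lintegral_liminf_le fun n => ?_).trans ?_
    · have := hQ n; fun_prop
    · have hδ0 : Tendsto (fun n => e + δ n) atTop (𝓝 (e + 0)) := by
        refine Tendsto.const_add e ?_
        rw [← ENNReal.ofReal_zero, ← mul_zero (k / 8)]
        exact ENNReal.tendsto_ofReal ((tendsto_pow_atTop_nhds_zero_of_lt_one (by norm_num)
          (by norm_num)).const_mul _)
      rw [add_zero] at hδ0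
      rw [← hδ0.liminf_eq]
      refine liminf_le_liminf (Eventually.of_forall fun n => ?_)
      rw [← pairEnergy_map hHm (hQ n)]
      exact hQe n
  exact ⟨_, hprob, ne_top_of_le_ne_top hetop hfatou, fun ρ hρ => hfatou.trans (hele ρ hρ)⟩

end ConfiningInteraction

/-! ### The support of the equilibrium measure -/

namespace ConfiningInteraction

variable {H : ℝ × ℝ → ENNReal} {k : ℝ}

theorem measurable_effectivePotential (h : ConfiningInteraction H k) (μ : Measure ℝ) [SFinite μ] :
    Measurable (effectivePotential H μ) :=
  h.continuous.measurable.lintegral_prod_right'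

theorem lintegral_effectivePotential (h : ConfiningInteraction H k) (μ : Measure ℝ) [SFinite μ] :
    ∫⁻ x, effectivePotential H μ x ∂μ = pairEnergy H μ :=
  (lintegral_prod _ h.continuous.measurable.aemeasurable).symm

/-- The energy is quadratic along the segment of mixtures of two measures. -/
theorem pairEnergy_mixture (h : ConfiningInteraction H k) (μ ν : Measure ℝ) [SFinite μ] [SFinite ν]
    (s t : ENNReal) :
    pairEnergy H (s • μ + t • ν) = s * s * pairEnergy H μ +
      2 * (s * t) * ∫⁻ x, effectivePotential H μ x ∂ν + t * t * pairEnergy H ν := by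
  have hm := h.measurable_effectivePotential
  have hHm := h.continuous.measurable
  have hswap : ∫⁻ x, effectivePotential H ν x ∂μ = ∫⁻ x, effectivePotential H μ x ∂ν := by
    simp only [effectivePotential]
    rw [lintegral_lintegral_swap (f := fun x y => H (x, y)) hHm.aemeasurable]
    simp_rw [h.symm]
  have hU : ∀ x, ∫⁻ y, H (x, y) ∂(s • μ + t • ν) =
      s * effectivePotential H μ x + t * effectivePotential H ν x := fun x => by
    rw [lintegral_add_measure, lintegral_smul_measure, lintegral_smul_measure]; rfl
  rw [pairEnergy, lintegral_prod _ hHm.aemeasurable]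
  simp only [hU, lintegral_add_measure, lintegral_smul_measure, smul_eq_mul]
  rw [lintegral_add_left ((hm μ).const_mul s), lintegral_add_left ((hm μ).const_mul s),
    lintegral_const_mul _ (hm μ), lintegral_const_mul _ (hm μ), lintegral_const_mul _ (hm ν),
    lintegral_const_mul _ (hm ν), hswap, h.lintegral_effectivePotential,
    h.lintegral_effectivePotential]
  ring

/-- First variation: moving a little mass of a minimiser to a competitor of finite energy does not
lower the energy. -/
theorem le_lintegral_effectivePotential (h : ConfiningInteraction H k) {μ ν : Measure ℝ}
    [IsProbabilityMeasure μ] [IsProbabilityMeasure ν] (hfin : pairEnergy H μ ≠ ⊤)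
    (hμ : ∀ ρ : Measure ℝ, IsProbabilityMeasure ρ → pairEnergy H μ ≤ pairEnergy H ρ)
    (hν : pairEnergy H ν ≠ ⊤) : pairEnergy H μ ≤ ∫⁻ x, effectivePotential H μ x ∂ν := by
  by_cases hB : ∫⁻ x, effectivePotential H μ x ∂ν = ⊤
  · rw [hB]; exact le_top
  set e := (pairEnergy H μ).toReal with he
  set f := (pairEnergy H ν).toReal with hf
  set B := (∫⁻ x, effectivePotential H μ x ∂ν).toReal with hBdef
  rw [← ENNReal.toReal_le_toReal hfin hB]
  have key : ∀ t ∈ Ioo (0 : ℝ) 1, 0 ≤ (t - 2) * e + 2 * (1 - t) * B + t * f := fun t ht => by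
    have hs : 0 ≤ 1 - t := by linarith [ht.2]
    have ht0 : 0 ≤ t := ht.1.le
    have he0 : 0 ≤ e := ENNReal.toReal_nonneg
    have hf0 : 0 ≤ f := ENNReal.toReal_nonneg
    have hB0 : 0 ≤ B := ENNReal.toReal_nonneg
    have hprob : IsProbabilityMeasure (ENNReal.ofReal (1 - t) • μ + ENNReal.ofReal t • ν) := ⟨by
      simp only [Measure.coe_add, Measure.coe_smul, Pi.add_apply, Pi.smul_apply, measure_univ,
        smul_eq_mul, mul_one]
      rw [← ENNReal.ofReal_add hs ht.1.le]; simp⟩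
    have h1 := hμ _ hprob
    rw [h.pairEnergy_mixture, ← ENNReal.ofReal_toReal hfin, ← ENNReal.ofReal_toReal hB,
      ← ENNReal.ofReal_toReal hν, ← he, ← hf, ← hBdef, ← ENNReal.ofReal_ofNat 2,
      ← ENNReal.ofReal_mul hs, ← ENNReal.ofReal_mul hs, ← ENNReal.ofReal_mul ht.1.le,
      ← ENNReal.ofReal_mul (by positivity), ← ENNReal.ofReal_mul (by positivity),
      ← ENNReal.ofReal_mul (by positivity), ← ENNReal.ofReal_mul (by positivity),
      ← ENNReal.ofReal_add (by positivity) (by positivity),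
      ← ENNReal.ofReal_add (by positivity) (by positivity),
      ENNReal.ofReal_le_ofReal_iff (by positivity)] at h1
    have h2 : 0 ≤ t * ((t - 2) * e + 2 * (1 - t) * B + t * f) := by linarith
    exact nonneg_of_mul_nonneg_right h2 ht.1
  have hlim : Tendsto (fun t : ℝ => (t - 2) * e + 2 * (1 - t) * B + t * f) (𝓝[>] 0)
      (𝓝 ((0 - 2) * e + 2 * (1 - 0) * B + 0 * f)) :=
    (Continuous.tendsto (by fun_prop) 0).mono_left nhdsWithin_le_nhds
  have := ge_of_tendsto hlim (Filter.mem_of_superset (Ioo_mem_nhdsGT one_pos) key)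
  linarith

/-- Euler-Lagrange equation: the effective potential of a minimiser is almost everywhere equal to
the minimal energy. -/
theorem effectivePotential_ae_eq (h : ConfiningInteraction H k) {μ : Measure ℝ}
    [IsProbabilityMeasure μ] (hfin : pairEnergy H μ ≠ ⊤)
    (hμ : ∀ ρ : Measure ℝ, IsProbabilityMeasure ρ → pairEnergy H μ ≤ pairEnergy H ρ) :
    ∀ᵐ x ∂μ, effectivePotential H μ x = pairEnergy H μ := by
  have hm := h.measurable_effectivePotential μ
  have hle : (fun _ => pairEnergy H μ) ≤ᵐ[μ] effectivePotential H μ := by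
    refine ae_le_of_forall_setLIntegral_le_of_sigmaFinite measurable_const fun S hS _ => ?_
    by_cases h0 : μ S = 0
    · simp [Measure.restrict_eq_zero.2 h0]
    have hi : (μ S)⁻¹ ≠ ⊤ := ENNReal.inv_ne_top.2 h0
    have hprob : IsProbabilityMeasure (ProbabilityTheory.cond μ S) :=
      ProbabilityTheory.cond_isProbabilityMeasure h0
    have hcond : pairEnergy H (ProbabilityTheory.cond μ S) ≠ ⊤ := by
      rw [h.pairEnergy_cond]
      refine ENNReal.mul_ne_top hi (ENNReal.mul_ne_top hi (ne_top_of_le_ne_top hfin ?_))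
      rw [← h.lintegral_effectivePotential]
      exact (lintegral_mono fun x => setLIntegral_le_lintegral _ _).trans
        (setLIntegral_le_lintegral _ _)
    have h1 := h.le_lintegral_effectivePotential hfin hμ hcond
    rw [ProbabilityTheory.cond, lintegral_smul_measure, smul_eq_mul] at h1
    rw [setLIntegral_const]
    calc pairEnergy H μ * μ S ≤ (μ S)⁻¹ * (∫⁻ x in S, effectivePotential H μ x ∂μ) * μ S :=
          mul_le_mul_left h1 _
      _ = ∫⁻ x in S, effectivePotential H μ x ∂μ := by
          rw [mul_comm, ← mul_assoc, ENNReal.mul_inv_cancel h0 (measure_ne_top μ S), one_mul]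
  have heq := ae_eq_of_ae_le_of_lintegral_le hle (by simpa using hfin) hm.aemeasurable
    (by rw [h.lintegral_effectivePotential]; simp)
  filter_upwards [heq] with x hx using hx.symm

/-- By Fatou's lemma the effective potential is lower semicontinuous, so that the Euler-Lagrange
equation gives an upper bound on the whole support. -/
theorem effectivePotential_le_of_mem_support (h : ConfiningInteraction H k) {μ : Measure ℝ}
    [IsProbabilityMeasure μ] (hfin : pairEnergy H μ ≠ ⊤)
    (hμ : ∀ ρ : Measure ℝ, IsProbabilityMeasure ρ → pairEnergy H μ ≤ pairEnergy H ρ)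
    {x : ℝ} (hx : x ∈ μ.support) : effectivePotential H μ x ≤ pairEnergy H μ := by
  have hclosed : IsClosed {x | effectivePotential H μ x ≤ pairEnergy H μ} := by
    refine IsSeqClosed.isClosed fun u x hu hux => ?_
    have hlim : ∀ y, H (x, y) = liminf (fun n => H (u n, y)) atTop := fun y =>
      (((h.continuous.tendsto (x, y)).comp
        (hux.prodMk_nhds tendsto_const_nhds)).liminf_eq).symm
    calc effectivePotential H μ x = ∫⁻ y, liminf (fun n => H (u n, y)) atTop ∂μ :=
          lintegral_congr hlim
      _ ≤ liminf (fun n => ∫⁻ y, H (u n, y) ∂μ) atTop :=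
          lintegral_liminf_le fun n => h.continuous.measurable.comp (by fun_prop)
      _ ≤ liminf (fun _ : ℕ => pairEnergy H μ) atTop :=
          liminf_le_liminf (Eventually.of_forall hu)
      _ = pairEnergy H μ := liminf_const _
  refine Measure.support_subset_of_isClosed hclosed ?_ hx
  filter_upwards [h.effectivePotential_ae_eq hfin hμ] with x hx using hx.le

theorem ofReal_abs_le_effectivePotential (h : ConfiningInteraction H k) (μ : Measure ℝ)
    [IsProbabilityMeasure μ] (x : ℝ) : ENNReal.ofReal |x| ≤ effectivePotential H μ x :=
  calc ENNReal.ofReal |x| = ∫⁻ _, ENNReal.ofReal |x| ∂μ := by simp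
    _ ≤ effectivePotential H μ x := lintegral_mono fun y =>
        (ENNReal.ofReal_le_ofReal (le_add_of_nonneg_right (abs_nonneg y))).trans (h.confining x y)

theorem isCompact_support (h : ConfiningInteraction H k) {μ : Measure ℝ}
    [IsProbabilityMeasure μ] (hfin : pairEnergy H μ ≠ ⊤)
    (hμ : ∀ ρ : Measure ℝ, IsProbabilityMeasure ρ → pairEnergy H μ ≤ pairEnergy H ρ) :
    IsCompact μ.support := by
  refine IsCompact.of_isClosed_subset
    (isCompact_Icc (a := -(pairEnergy H μ).toReal) (b := (pairEnergy H μ).toReal))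
    Measure.isClosed_support fun x hx => ?_
  rw [mem_Icc, ← abs_le, ← ENNReal.ofReal_le_iff_le_toReal hfin]
  exact (h.ofReal_abs_le_effectivePotential μ x).trans
    (h.effectivePotential_le_of_mem_support hfin hμ hx)

/-- Inside a gap of the support the effective potential is strongly convex, hence strictly below
the minimal energy; the uniform distribution on the gap then contradicts the first variation. -/
theorem not_gap (h : ConfiningInteraction H k) {μ : Measure ℝ}
    [IsProbabilityMeasure μ] (hfin : pairEnergy H μ ≠ ⊤)
    (hμ : ∀ ρ : Measure ℝ, IsProbabilityMeasure ρ → pairEnergy H μ ≤ pairEnergy H ρ)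
    {u v : ℝ} (hu : u ∈ μ.support) (hv : v ∈ μ.support) (huv : u < v)
    (hgap : ∀ y ∈ μ.support, y ≤ u ∨ v ≤ y) : False := by
  have hm := h.measurable_effectivePotential μ
  have hk := h.pos
  have hlt : ∀ x ∈ Ioo u v, effectivePotential H μ x < pairEnergy H μ := fun x hx => by
    have hw : 0 < v - u := sub_pos.2 huv
    set a := (v - x) / (v - u) with ha
    set b := (x - u) / (v - u) with hb
    have ha0 : 0 < a := div_pos (sub_pos.2 hx.2) hw
    have hb0 : 0 < b := div_pos (sub_pos.2 hx.1) hw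
    have hab : a + b = 1 := by rw [ha, hb]; field_simp; ring
    have hxab : a * u + b * v = x := by rw [ha, hb]; field_simp; ring
    have hpt : ∀ᵐ y ∂μ, H (x, y) + ENNReal.ofReal (k * (a * b) * (u - v) ^ 2) ≤
        ENNReal.ofReal a * H (u, y) + ENNReal.ofReal b * H (v, y) := by
      filter_upwards [Measure.support_mem_ae (μ := μ)] with y hy
      have hyab : a * y + b * y = y := by rw [← add_mul, hab, one_mul]
      rcases hgap y hy with hle | hle
      · have := h.convex y u y v a b hle (hle.trans huv.le) ha0 hb0 hab
        rw [hxab, hyab, sub_self, zero_pow two_ne_zero, zero_add] at this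
        rwa [h.symm, h.symm u, h.symm v]
      · have := h.convex u y v y a b (huv.le.trans hle) hle ha0 hb0 hab
        rwa [hxab, hyab, sub_self, zero_pow two_ne_zero, add_zero] at this
    have hint := lintegral_mono_ae hpt
    have hHx : ∀ z, Measurable fun y => H (z, y) := fun z =>
      h.continuous.measurable.comp (by fun_prop)
    rw [lintegral_add_left (hHx x), lintegral_add_left ((hHx u).const_mul _),
      lintegral_const_mul _ (hHx u), lintegral_const_mul _ (hHx v), lintegral_const,
      measure_univ, mul_one] at hint
    have hle : effectivePotential H μ x + ENNReal.ofReal (k * (a * b) * (u - v) ^ 2) ≤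
        pairEnergy H μ :=
      calc _ ≤ ENNReal.ofReal a * effectivePotential H μ u +
            ENNReal.ofReal b * effectivePotential H μ v := hint
        _ ≤ ENNReal.ofReal a * pairEnergy H μ + ENNReal.ofReal b * pairEnergy H μ :=
            add_le_add (mul_le_mul_right (h.effectivePotential_le_of_mem_support hfin hμ hu) _)
              (mul_le_mul_right (h.effectivePotential_le_of_mem_support hfin hμ hv) _)
        _ = pairEnergy H μ := by
            rw [← add_mul, ← ENNReal.ofReal_add ha0.le hb0.le, hab, ENNReal.ofReal_one, one_mul]
    refine lt_of_lt_of_le (ENNReal.lt_add_right ?_ (ENNReal.ofReal_pos.2 ?_).ne') hle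
    · exact ne_top_of_le_ne_top hfin (le_self_add.trans hle)
    · have : u - v ≠ 0 := by linarith
      positivity
  have hvol : volume (Ioo u v) ≠ 0 := by simpa using huv
  have hprob : IsProbabilityMeasure (ProbabilityTheory.cond volume (Ioo u v)) :=
    ProbabilityTheory.cond_isProbabilityMeasure_of_finite hvol (by simp)
  have hcond : pairEnergy H (ProbabilityTheory.cond volume (Ioo u v)) ≠ ⊤ := by
    rw [h.pairEnergy_cond]
    have hi := ENNReal.inv_ne_top.2 hvol
    exact ENNReal.mul_ne_top hi (ENNReal.mul_ne_top hi (h.lintegral_ne_top u v huv))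
  have h1 := h.le_lintegral_effectivePotential hfin hμ hcond
  have hae : ∀ᵐ x ∂(ProbabilityTheory.cond volume (Ioo u v)),
      effectivePotential H μ x < pairEnergy H μ := by
    filter_upwards [ProbabilityTheory.ae_cond_mem measurableSet_Ioo] with x hx using hlt x hx
  have h2 : ∫⁻ x, effectivePotential H μ x ∂(ProbabilityTheory.cond volume (Ioo u v)) <
      ∫⁻ _, pairEnergy H μ ∂(ProbabilityTheory.cond volume (Ioo u v)) := by
    refine lintegral_strict_mono (IsProbabilityMeasure.ne_zero _) measurable_const.aemeasurable
      (ne_top_of_le_ne_top hfin ?_) hae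
    calc _ ≤ ∫⁻ _, pairEnergy H μ ∂(ProbabilityTheory.cond volume (Ioo u v)) :=
          lintegral_mono_ae (hae.mono fun _ => le_of_lt)
      _ = pairEnergy H μ := by simp
  rw [lintegral_const, measure_univ, mul_one] at h2
  exact absurd h1 (not_le.2 h2)

theorem support_eq_Icc (h : ConfiningInteraction H k) {μ : Measure ℝ}
    [IsProbabilityMeasure μ] (hfin : pairEnergy H μ ≠ ⊤)
    (hμ : ∀ ρ : Measure ℝ, IsProbabilityMeasure ρ → pairEnergy H μ ≤ pairEnergy H ρ) :
    ∃ a c : ℝ, a < c ∧ μ.support = Icc a c := by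
  have hcomp := h.isCompact_support hfin hμ
  have hne : μ.support.Nonempty := Measure.nonempty_support (IsProbabilityMeasure.ne_zero μ)
  obtain ⟨a, ha⟩ := hcomp.exists_isLeast hne
  obtain ⟨c, hc⟩ := hcomp.exists_isGreatest hne
  have hsub : Icc a c ⊆ μ.support := fun z hz => by
    by_contra hzs
    obtain ⟨u, hu⟩ := (hcomp.inter_right isClosed_Iic).exists_isGreatest ⟨a, ha.1, hz.1⟩
    obtain ⟨v, hv⟩ := (hcomp.inter_right isClosed_Ici).exists_isLeast ⟨c, hc.1, hz.2⟩
    have hne' : ∀ w ∈ μ.support, w ≠ z := fun w hw e => hzs (e ▸ hw)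
    refine h.not_gap hfin hμ hu.1.1 hv.1.1
      ((lt_of_le_of_ne hu.1.2 (hne' u hu.1.1)).trans
        (lt_of_le_of_ne hv.1.2 (hne' v hv.1.1).symm)) fun y hy => ?_
    exact (le_total y z).imp (fun hyz => hu.2 ⟨hy, hyz⟩) fun hyz => hv.2 ⟨hy, hyz⟩
  have heq : μ.support = Icc a c :=
    Subset.antisymm (fun x hx => ⟨ha.2 hx, hc.2 hx⟩) hsub
  refine ⟨a, c, lt_of_le_of_ne (ha.2 hc.1) fun hac => hfin ?_, heq⟩
  -- A one-point support would be an atom, which has infinite energy.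
  have hpt : ∀ᵐ x ∂μ, x = a := by
    filter_upwards [Measure.support_mem_ae (μ := μ)] with x hx
    rw [heq, ← hac, Icc_self] at hx
    exact hx
  rw [← h.lintegral_effectivePotential]
  have hU : ∀ᵐ x ∂μ, effectivePotential H μ x = ⊤ := by
    filter_upwards [hpt] with x hx
    have : ∀ᵐ y ∂μ, H (x, y) = ⊤ := by
      filter_upwards [hpt] with y hy
      rw [hx, hy, h.diag]
    rw [effectivePotential, lintegral_congr_ae this]
    simp
  rw [lintegral_congr_ae hU]
  simp

end ConfiningInteraction

/-! ### The energy density of a strongly convex potential -/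

theorem StrongConvexOn.continuous_univ {V : ℝ → ℝ} {m : ℝ} (hV : StrongConvexOn univ m V)
    (hm : 0 < m) : Continuous V :=
  continuousOn_univ.1 ((hV.strictConvexOn hm).convexOn.continuousOn isOpen_univ)

/-- A strongly convex function on the line grows faster than any multiple of `|x|`. -/
theorem StrongConvexOn.exists_mul_abs_le {V : ℝ → ℝ} {m : ℝ} (hV : StrongConvexOn univ m V)
    (hm : 0 < m) {A : ℝ} (hA : 0 ≤ A) : ∃ B, 0 ≤ B ∧ ∀ x, A * |x| ≤ V x + B := by
  obtain ⟨x₀, -, hx₀⟩ := (isCompact_Icc (a := (-1 : ℝ)) (b := 1)).exists_isMinOn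
    ⟨0, by norm_num, by norm_num⟩ (hV.continuous_univ hm).continuousOn
  set P := V x₀ - V 0 - m / 2 - A with hP
  refine ⟨|V x₀| + |V 0| + A + P ^ 2 / (2 * m), by positivity, fun x => ?_⟩
  have hPm : 0 ≤ P ^ 2 / (2 * m) := by positivity
  rcases le_total |x| 1 with hx | hx
  · have h1 : V x₀ ≤ V x := hx₀ (abs_le.1 hx)
    nlinarith [neg_abs_le (V x₀), abs_nonneg (V 0)]
  · -- The point `x / |x| ∈ [-1, 1]` is a convex combination of `0` and `x`; strong convexity
    -- there bounds `V x` from below by a quadratic in `|x|`.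
    have hx0 : 0 < |x| := by linarith
    have hmem : x / |x| ∈ Icc (-1 : ℝ) 1 := abs_le.1 (by rw [abs_div, abs_abs, div_self hx0.ne'])
    have h1 : V x₀ ≤ V (x / |x|) := hx₀ hmem
    have hb1 : 1 / |x| ≤ 1 := (div_le_one hx0).2 hx
    have h2 := hV.2 (mem_univ 0) (mem_univ x) (sub_nonneg.2 hb1) (by positivity)
      (sub_add_cancel 1 (1 / |x|))
    have e : (1 - 1 / |x|) • (0 : ℝ) + (1 / |x|) • x = x / |x| := by
      simp only [smul_eq_mul]; ring
    rw [e, zero_sub, norm_neg, Real.norm_eq_abs] at h2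
    simp only [smul_eq_mul] at h2
    have h3 := h1.trans h2
    have e2 : (1 - 1 / |x|) * V 0 + 1 / |x| * V x - (1 - 1 / |x|) * (1 / |x|) * (m / 2 * |x| ^ 2) =
        ((|x| - 1) * V 0 + V x - (|x| - 1) * (m / 2 * |x|)) / |x| := by
      field_simp
    rw [e2, le_div_iff₀ hx0] at h3
    have h4 : 0 ≤ m / 2 * (|x| + P / m) ^ 2 := by positivity
    have e3 : m / 2 * (|x| + P / m) ^ 2 = m / 2 * |x| ^ 2 + P * |x| + P ^ 2 / (2 * m) := by
      field_simp
      ring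
    nlinarith [neg_abs_le (V 0), abs_nonneg (V x₀)]

theorem concaveOn_log_sinh : ConcaveOn ℝ (Ioi 0) fun x => Real.log (Real.sinh x) := by
  have hd : ∀ x ∈ Ioi (0 : ℝ), HasDerivAt (fun x => Real.log (Real.sinh x))
      (Real.cosh x / Real.sinh x) x := fun x hx =>
    (Real.hasDerivAt_sinh x).log (Real.sinh_pos_iff.2 hx).ne'
  refine AntitoneOn.concaveOn_of_deriv (convex_Ioi 0)
    (fun x hx => (hd x hx).continuousAt.continuousWithinAt) ?_ ?_
  · rw [interior_Ioi]
    exact fun x hx => (hd x hx).differentiableAt.differentiableWithinAt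
  · rw [interior_Ioi]
    intro x hx y hy hxy
    rw [(hd x hx).deriv, (hd y hy).deriv, div_le_div_iff₀ (Real.sinh_pos_iff.2 hy)
      (Real.sinh_pos_iff.2 hx)]
    have := Real.sinh_nonneg_iff.2 (sub_nonneg.2 hxy)
    rw [Real.sinh_sub] at this
    linarith

section

variable {N : ℕ} {ω₁ ω₂ : ℝ}

theorem tauN_pos (hN : 2 ≤ N) : 0 < tauN N := Real.log_pos (by exact_mod_cast hN)

theorem scaledPeriod_pos (hN : 2 ≤ N) {ω : ℝ} (hω : 0 < ω) : 0 < scaledPeriod N ω := by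
  have := tauN_pos hN
  unfold scaledPeriod
  positivity

theorem sinhProduct_comm (s t : ℝ) : sinhProduct N ω₁ ω₂ s t = sinhProduct N ω₁ ω₂ t s := by
  have h : ∀ w : ℝ, w * ((s - t) / 2) = -(w * ((t - s) / 2)) := fun w => by ring
  rw [sinhProduct, sinhProduct, h, h, Real.sinh_neg, Real.sinh_neg, neg_mul_neg]

theorem sinhProduct_self (s : ℝ) : sinhProduct N ω₁ ω₂ s s = 0 := by simp [sinhProduct]

theorem continuous_sinhProduct :
    Continuous fun p : ℝ × ℝ => sinhProduct N ω₁ ω₂ p.1 p.2 := by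
  unfold sinhProduct; fun_prop

theorem log_sinhProduct (hN : 2 ≤ N) (hω₁ : 0 < ω₁) (hω₂ : 0 < ω₂) {s t : ℝ} (h : s < t) :
    0 < sinhProduct N ω₁ ω₂ s t ∧ Real.log (sinhProduct N ω₁ ω₂ s t) =
      Real.log (Real.sinh (scaledPeriod N ω₁ / 2 * (t - s))) +
        Real.log (Real.sinh (scaledPeriod N ω₂ / 2 * (t - s))) := by
  have h1 := scaledPeriod_pos hN hω₁
  have h2 := scaledPeriod_pos hN hω₂
  have hts := sub_pos.2 h
  have e : sinhProduct N ω₁ ω₂ s t = Real.sinh (scaledPeriod N ω₁ / 2 * (t - s)) *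
      Real.sinh (scaledPeriod N ω₂ / 2 * (t - s)) := by
    rw [sinhProduct_comm, sinhProduct]
    congr 2 <;> ring
  have p1 : 0 < Real.sinh (scaledPeriod N ω₁ / 2 * (t - s)) := Real.sinh_pos_iff.2 (by positivity)
  have p2 : 0 < Real.sinh (scaledPeriod N ω₂ / 2 * (t - s)) := Real.sinh_pos_iff.2 (by positivity)
  exact ⟨e ▸ mul_pos p1 p2, by rw [e, Real.log_mul p1.ne' p2.ne']⟩

theorem sinhProduct_pos (hN : 2 ≤ N) (hω₁ : 0 < ω₁) (hω₂ : 0 < ω₂) {s t : ℝ} (h : s ≠ t) :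
    0 < sinhProduct N ω₁ ω₂ s t := by
  rcases lt_or_gt_of_ne h with h | h
  · exact (log_sinhProduct hN hω₁ hω₂ h).1
  · rw [sinhProduct_comm]; exact (log_sinhProduct hN hω₁ hω₂ h).1

/-- The logarithmic interaction is concave on the half plane `s < t`. -/
theorem log_sinhProduct_concave (hN : 2 ≤ N) (hω₁ : 0 < ω₁) (hω₂ : 0 < ω₂)
    {x y x' y' a b : ℝ} (h : x < y) (h' : x' < y') (ha : 0 < a) (hb : 0 < b) (hab : a + b = 1) :
    a * Real.log (sinhProduct N ω₁ ω₂ x y) + b * Real.log (sinhProduct N ω₁ ω₂ x' y') ≤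
      Real.log (sinhProduct N ω₁ ω₂ (a * x + b * x') (a * y + b * y')) := by
  have hm : a * x + b * x' < a * y + b * y' :=
    add_lt_add (mul_lt_mul_of_pos_left h ha) (mul_lt_mul_of_pos_left h' hb)
  have key : ∀ {w : ℝ}, 0 < w → a * Real.log (Real.sinh (w / 2 * (y - x))) +
      b * Real.log (Real.sinh (w / 2 * (y' - x'))) ≤
      Real.log (Real.sinh (w / 2 * (a * y + b * y' - (a * x + b * x')))) := fun {w} hw => by
    have := concaveOn_log_sinh.2 (x := w / 2 * (y - x)) (mem_Ioi.2 (by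
      have := sub_pos.2 h; positivity)) (y := w / 2 * (y' - x')) (mem_Ioi.2 (by
      have := sub_pos.2 h'; positivity)) ha.le hb.le hab
    simp only [smul_eq_mul] at this
    refine this.trans (le_of_eq ?_)
    congr 2; ring
  rw [(log_sinhProduct hN hω₁ hω₂ h).2, (log_sinhProduct hN hω₁ hω₂ h').2,
    (log_sinhProduct hN hω₁ hω₂ hm).2]
  linarith [key (scaledPeriod_pos hN hω₁), key (scaledPeriod_pos hN hω₂)]

theorem log_sinhProduct_le (hN : 2 ≤ N) (hω₁ : 0 < ω₁) (hω₂ : 0 < ω₂) {s t : ℝ} (h : s ≠ t) :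
    Real.log (sinhProduct N ω₁ ω₂ s t) ≤
      (scaledPeriod N ω₁ + scaledPeriod N ω₂) / 2 * (|s| + |t|) := by
  have h1 := scaledPeriod_pos hN hω₁
  have h2 := scaledPeriod_pos hN hω₂
  wlog hst : s < t generalizing s t
  · rw [sinhProduct_comm, add_comm |s|]
    exact this h.symm (lt_of_le_of_ne (not_lt.1 hst) h.symm)
  have key : ∀ {w : ℝ}, 0 < w → Real.log (Real.sinh (w / 2 * (t - s))) ≤ w / 2 * (t - s) :=
    fun {w} hw => by
      have hpos : 0 < w / 2 * (t - s) := by have := sub_pos.2 hst; positivity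
      rw [Real.log_le_iff_le_exp (Real.sinh_pos_iff.2 hpos), Real.sinh_eq]
      linarith [Real.exp_pos (w / 2 * (t - s)), Real.exp_pos (-(w / 2 * (t - s)))]
  rw [(log_sinhProduct hN hω₁ hω₂ hst).2]
  nlinarith [key h1, key h2, neg_abs_le s, le_abs_self t]

theorem le_log_sinhProduct (hN : 2 ≤ N) (hω₁ : 0 < ω₁) (hω₂ : 0 < ω₂) {s t : ℝ} (h : s ≠ t) :
    Real.log (scaledPeriod N ω₁ / 2) + Real.log (scaledPeriod N ω₂ / 2) + 2 * Real.log (s - t) ≤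
      Real.log (sinhProduct N ω₁ ω₂ s t) := by
  have h1 := scaledPeriod_pos hN hω₁
  have h2 := scaledPeriod_pos hN hω₂
  wlog hst : s < t generalizing s t
  · rw [sinhProduct_comm, ← Real.log_neg_eq_log (s - t), neg_sub]
    exact this h.symm (lt_of_le_of_ne (not_lt.1 hst) h.symm)
  have hts := sub_pos.2 hst
  have key : ∀ {w : ℝ}, 0 < w → Real.log (w / 2) + Real.log (t - s) ≤
      Real.log (Real.sinh (w / 2 * (t - s))) := fun {w} hw => by
    have hpos : 0 < w / 2 * (t - s) := by positivity
    rw [← Real.log_mul (by positivity) hts.ne']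
    exact Real.log_le_log hpos (Real.self_le_sinh_iff.2 hpos.le)
  rw [(log_sinhProduct hN hω₁ hω₂ hst).2, ← Real.log_neg_eq_log (s - t), neg_sub]
  linarith [key h1, key h2]

/-- The logarithmic singularity on the diagonal is integrable over bounded squares. -/
theorem lintegral_enorm_log_sub_ne_top (u v : ℝ) :
    ∫⁻ x in Ioo u v, ∫⁻ y in Ioo u v, ‖Real.log (x - y)‖ₑ ≠ ⊤ := by
  rcases le_or_gt v u with huv | huv
  · simp [Ioo_eq_empty (not_lt.2 huv)]
  set M := ∫⁻ z in Ioo (-(v - u)) (v - u), ‖Real.log z‖ₑ with hM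
  have hMtop : M ≠ ⊤ := by
    have h1 : IntegrableOn Real.log (Ioc (-(v - u)) (v - u)) volume :=
      (intervalIntegrable_iff_integrableOn_Ioc_of_le (by linarith)).1
        intervalIntegral.intervalIntegrable_log'
    exact (h1.mono_set Ioo_subset_Ioc_self).2.ne
  have hle : ∀ x ∈ Ioo u v, ∫⁻ y in Ioo u v, ‖Real.log (x - y)‖ₑ ≤ M := fun x hx => by
    have hpres := (volume : Measure ℝ).measurePreserving_sub_left x
    have hind : Measurable ((Ioo (-(v - u)) (v - u)).indicator fun z => ‖Real.log z‖ₑ) :=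
      Real.measurable_log.enorm.indicator measurableSet_Ioo
    rw [hM, ← lintegral_indicator measurableSet_Ioo (fun z => ‖Real.log z‖ₑ), ← hpres.lintegral_comp hind,
      ← lintegral_indicator measurableSet_Ioo]
    refine lintegral_mono fun y => ?_
    by_cases hy : y ∈ Ioo u v
    · rw [indicator_of_mem hy, indicator_of_mem]
      exact ⟨by linarith [hx.1, hy.2], by linarith [hx.2, hy.1]⟩
    · rw [indicator_of_notMem hy]; exact zero_le
  refine ne_top_of_le_ne_top (ENNReal.mul_ne_top hMtop (by simp : volume (Ioo u v) ≠ ⊤)) ?_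
  rw [← setLIntegral_const]
  exact setLIntegral_mono measurable_const hle

/-- The energy density shifted by a constant `C`, as an extended nonnegative number. -/
def shiftedDensity (V : ℝ → ℝ) (N : ℕ) (ω₁ ω₂ C : ℝ) (p : ℝ × ℝ) : ENNReal :=
  (energyDensity V N ω₁ ω₂ p + (C : EReal)).toENNReal

variable {V : ℝ → ℝ} {C : ℝ}

theorem energyDensity_of_ne (hN : 2 ≤ N) (hω₁ : 0 < ω₁) (hω₂ : 0 < ω₂) {s t : ℝ} (h : s ≠ t) :
    energyDensity V N ω₁ ω₂ (s, t) = (((V s + V t) / 2 -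
      1 / (2 * tauN N) * Real.log (sinhProduct N ω₁ ω₂ s t) : ℝ) : EReal) := by
  rw [energyDensity, ENNReal.log_ofReal_of_pos (sinhProduct_pos hN hω₁ hω₂ h)]
  norm_cast

theorem energyDensity_self (hN : 2 ≤ N) (s : ℝ) : energyDensity V N ω₁ ω₂ (s, s) = ⊤ := by
  have h : 0 < 1 / (2 * tauN N) := by have := tauN_pos hN; positivity
  simp only [energyDensity, sinhProduct_self, ENNReal.ofReal_zero, ENNReal.log_zero]
  rw [EReal.coe_mul_bot_of_pos h, EReal.coe_sub_bot]

theorem shiftedDensity_of_ne (hN : 2 ≤ N) (hω₁ : 0 < ω₁) (hω₂ : 0 < ω₂) {s t : ℝ} (h : s ≠ t) :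
    shiftedDensity V N ω₁ ω₂ C (s, t) = ENNReal.ofReal ((V s + V t) / 2 -
      1 / (2 * tauN N) * Real.log (sinhProduct N ω₁ ω₂ s t) + C) := by
  rw [shiftedDensity, energyDensity_of_ne hN hω₁ hω₂ h, ← EReal.coe_add,
    EReal.real_coe_toENNReal]

theorem shiftedDensity_self (hN : 2 ≤ N) (s : ℝ) :
    shiftedDensity V N ω₁ ω₂ C (s, s) = ⊤ := by
  rw [shiftedDensity, energyDensity_self hN, EReal.top_add_coe, EReal.toENNReal_top]

theorem continuous_energyDensity (hV : Continuous V) : Continuous (energyDensity V N ω₁ ω₂) := by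
  rw [continuous_iff_continuousAt]
  intro p
  have h1 : ContinuousAt (fun p : ℝ × ℝ => (((V p.1 + V p.2) / 2 : ℝ) : EReal)) p :=
    (continuous_coe_real_ereal.comp (by fun_prop)).continuousAt
  have h2 : ContinuousAt (fun p : ℝ × ℝ =>
      ENNReal.log (ENNReal.ofReal (sinhProduct N ω₁ ω₂ p.1 p.2))) p :=
    (ENNReal.continuous_log.comp
      (ENNReal.continuous_ofReal.comp continuous_sinhProduct)).continuousAt
  have h3 : ContinuousAt (fun p : ℝ × ℝ => -(((1 / (2 * tauN N) : ℝ) : EReal) *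
      ENNReal.log (ENNReal.ofReal (sinhProduct N ω₁ ω₂ p.1 p.2)))) p :=
    continuous_neg.continuousAt.comp
      (EReal.Tendsto.const_mul h2 (Or.inl (EReal.coe_ne_bot _)) (Or.inl (EReal.coe_ne_top _)))
  exact (EReal.continuousAt_add (Or.inl (EReal.coe_ne_top _))
    (Or.inl (EReal.coe_ne_bot _))).comp (h1.prodMk h3)

theorem continuous_shiftedDensity (hV : Continuous V) :
    Continuous (shiftedDensity V N ω₁ ω₂ C) := by
  refine continuous_iff_continuousAt.2 fun p => ContinuousAt.ereal_toENNReal ?_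
  exact (EReal.continuousAt_add (Or.inr (EReal.coe_ne_bot _))
    (Or.inr (EReal.coe_ne_top _))).comp
      ((continuous_energyDensity hV).continuousAt.prodMk continuousAt_const)

/-- For a strongly convex potential, quadratic growth beats the linear growth of the logarithmic
interaction, so that a shift of the energy density is a confining interaction. -/
theorem exists_confiningInteraction_shiftedDensity {m : ℝ} (hV : StrongConvexOn univ m V)
    (hm : 0 < m) (hN : 2 ≤ N) (hω₁ : 0 < ω₁) (hω₂ : 0 < ω₂) :
    ∃ C : ℝ, 0 ≤ C ∧ (∀ p, ((-C : ℝ) : EReal) ≤ energyDensity V N ω₁ ω₂ p) ∧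
      ConfiningInteraction (shiftedDensity V N ω₁ ω₂ C) (m / 4) := by
  have hVc := hV.continuous_univ hm
  have hc : 0 < 1 / (2 * tauN N) := by have := tauN_pos hN; positivity
  set c := 1 / (2 * tauN N) with hcdef
  have hw : 0 < (scaledPeriod N ω₁ + scaledPeriod N ω₂) / 2 := by
    have := scaledPeriod_pos hN hω₁
    have := scaledPeriod_pos hN hω₂
    positivity
  set w := (scaledPeriod N ω₁ + scaledPeriod N ω₂) / 2 with hwdef
  obtain ⟨C, hC0, hC⟩ := hV.exists_mul_abs_le hm (A := 2 * (1 + c * w)) (by positivity)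
  have hlow : ∀ {s t : ℝ}, s ≠ t → |s| + |t| ≤
      (V s + V t) / 2 - c * Real.log (sinhProduct N ω₁ ω₂ s t) + C := fun {s t} h => by
    have h1 := mul_le_mul_of_nonneg_left (log_sinhProduct_le hN hω₁ hω₂ h) hc.le
    rw [← hwdef] at h1
    linarith [hC s, hC t]
  refine ⟨C, hC0, fun p => ?_, ?_⟩
  · obtain ⟨s, t⟩ := p
    by_cases h : s = t
    · rw [h, energyDensity_self hN]; exact le_top
    · rw [energyDensity_of_ne hN hω₁ hω₂ h, EReal.coe_le_coe_iff]
      linarith [hlow h, abs_nonneg s, abs_nonneg t]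
  · refine ⟨by positivity, continuous_shiftedDensity hVc, fun x y => ?_,
      fun x => shiftedDensity_self hN x, ?_, fun x y => ?_, fun u v huv => ?_⟩
    · by_cases h : x = y
      · rw [h]
      · rw [shiftedDensity_of_ne hN hω₁ hω₂ h, shiftedDensity_of_ne hN hω₁ hω₂ (Ne.symm h),
          sinhProduct_comm, add_comm (V x)]
    · intro x y x' y' a b hxy hxy' ha hb hab
      rcases hxy.eq_or_lt with rfl | hlt
      · rw [shiftedDensity_self hN, ENNReal.mul_top (by simpa using ha), top_add]
        exact le_top
      rcases hxy'.eq_or_lt with rfl | hlt'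
      · rw [shiftedDensity_self hN, ENNReal.mul_top (by simpa using hb), add_top]
        exact le_top
      have hmid : a * x + b * x' < a * y + b * y' :=
        add_lt_add (mul_lt_mul_of_pos_left hlt ha) (mul_lt_mul_of_pos_left hlt' hb)
      have nn : ∀ {s t : ℝ}, s ≠ t →
          0 ≤ (V s + V t) / 2 - c * Real.log (sinhProduct N ω₁ ω₂ s t) + C := fun {s t} h =>
        (add_nonneg (abs_nonneg s) (abs_nonneg t)).trans (hlow h)
      rw [shiftedDensity_of_ne hN hω₁ hω₂ hlt.ne, shiftedDensity_of_ne hN hω₁ hω₂ hlt'.ne,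
        shiftedDensity_of_ne hN hω₁ hω₂ hmid.ne, ← ENNReal.ofReal_mul ha.le,
        ← ENNReal.ofReal_mul hb.le, ← ENNReal.ofReal_add (nn hmid.ne) (by positivity),
        ← ENNReal.ofReal_add (mul_nonneg ha.le (nn hlt.ne)) (mul_nonneg hb.le (nn hlt'.ne))]
      refine ENNReal.ofReal_le_ofReal ?_
      have hVx := hV.2 (mem_univ x) (mem_univ x') ha.le hb.le hab
      have hVy := hV.2 (mem_univ y) (mem_univ y') ha.le hb.le hab
      simp only [smul_eq_mul, Real.norm_eq_abs, sq_abs] at hVx hVy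
      have hl := mul_le_mul_of_nonneg_left
        (log_sinhProduct_concave hN hω₁ hω₂ hlt hlt' ha hb hab) hc.le
      have hCab : a * C + b * C = C := by rw [← add_mul, hab, one_mul]
      linarith
    · by_cases h : x = y
      · rw [h, shiftedDensity_self hN]; exact le_top
      · rw [shiftedDensity_of_ne hN hω₁ hω₂ h]
        exact ENNReal.ofReal_le_ofReal (hlow h)
    · obtain ⟨R, hR⟩ := (isCompact_Icc (a := u) (b := v)).exists_bound_of_continuousOn
        hVc.continuousOn
      set B := R + C - c * (Real.log (scaledPeriod N ω₁ / 2) + Real.log (scaledPeriod N ω₂ / 2))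
        with hB
      have hpt : ∀ x ∈ Ioo u v, ∀ᵐ y ∂(volume.restrict (Ioo u v)),
          shiftedDensity V N ω₁ ω₂ C (x, y) ≤
            ENNReal.ofReal B + ENNReal.ofReal (2 * c) * ‖Real.log (x - y)‖ₑ := fun x hx => by
        filter_upwards [ae_restrict_mem measurableSet_Ioo,
          ae_restrict_of_ae (Measure.ae_ne volume x)] with y hy hyx
        rw [shiftedDensity_of_ne hN hω₁ hω₂ hyx.symm, Real.enorm_eq_ofReal_abs,
          ← ENNReal.ofReal_mul (by positivity)]
        refine (ENNReal.ofReal_le_ofReal ?_).trans ENNReal.ofReal_add_le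
        have h1 := (abs_le.1 (hR x (Ioo_subset_Icc_self hx))).2
        have h2 := (abs_le.1 (hR y (Ioo_subset_Icc_self hy))).2
        have h3 := mul_le_mul_of_nonneg_left (le_log_sinhProduct hN hω₁ hω₂ hyx.symm) hc.le
        have h4 := mul_le_mul_of_nonneg_left (neg_abs_le (Real.log (x - y))) hc.le
        rw [← hcdef, hB]
        linarith
      have hle : ∫⁻ x in Ioo u v, ∫⁻ y in Ioo u v, shiftedDensity V N ω₁ ω₂ C (x, y) ≤
          ∫⁻ x in Ioo u v, ∫⁻ y in Ioo u v,
            (ENNReal.ofReal B + ENNReal.ofReal (2 * c) * ‖Real.log (x - y)‖ₑ) :=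
        lintegral_mono_ae <| by
          filter_upwards [ae_restrict_mem measurableSet_Ioo] with x hx
          exact lintegral_mono_ae (hpt x hx)
      refine ne_top_of_le_ne_top ?_ hle
      have hmeas : Measurable fun x : ℝ => ∫⁻ y in Ioo u v, ‖Real.log (x - y)‖ₑ :=
        Measurable.lintegral_prod_right'
          (f := fun p : ℝ × ℝ => ‖Real.log (p.1 - p.2)‖ₑ) (by fun_prop)
      have hin : ∀ x : ℝ, ∫⁻ y in Ioo u v,
          (ENNReal.ofReal B + ENNReal.ofReal (2 * c) * ‖Real.log (x - y)‖ₑ) =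
          ENNReal.ofReal B * volume (Ioo u v) +
            ENNReal.ofReal (2 * c) * ∫⁻ y in Ioo u v, ‖Real.log (x - y)‖ₑ := fun x => by
        rw [lintegral_add_left measurable_const, setLIntegral_const,
          lintegral_const_mul _ (by fun_prop)]
      simp_rw [hin]
      rw [lintegral_add_left measurable_const, setLIntegral_const, lintegral_const_mul _ hmeas]
      have hvol : volume (Ioo u v) ≠ ⊤ := by simp
      exact ENNReal.add_ne_top.2
        ⟨ENNReal.mul_ne_top (ENNReal.mul_ne_top ENNReal.ofReal_ne_top hvol) hvol,
          ENNReal.mul_ne_top ENNReal.ofReal_ne_top (lintegral_enorm_log_sub_ne_top u v)⟩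

/-- The energy functional is the pair energy of the shifted density, shifted back. -/
theorem energy_eq_pairEnergy_sub (hV : Continuous V) (hC : 0 ≤ C)
    (hlow : ∀ p, ((-C : ℝ) : EReal) ≤ energyDensity V N ω₁ ω₂ p) (μ : Measure ℝ)
    [IsProbabilityMeasure μ] :
    energy V N ω₁ ω₂ μ = (pairEnergy (shiftedDensity V N ω₁ ω₂ C) μ : EReal) - (C : EReal) := by
  have hH := (continuous_shiftedDensity (N := N) (ω₁ := ω₁) (ω₂ := ω₂) (C := C) hV).measurable
  -- The identity `d⁺ + C = (d + C) + d⁻` for the energy density `d ≥ -C`.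
  have hpt : ∀ p, (energyDensity V N ω₁ ω₂ p).toENNReal + ENNReal.ofReal C =
      shiftedDensity V N ω₁ ω₂ C p + (-energyDensity V N ω₁ ω₂ p).toENNReal := fun p => by
    have h := hlow p
    rw [shiftedDensity]
    generalize energyDensity V N ω₁ ω₂ p = d at h ⊢
    induction d with
    | bot => exact absurd h (not_le.2 (EReal.bot_lt_coe _))
    | top => simp
    | coe x =>
      rw [EReal.coe_le_coe_iff] at h
      rw [← EReal.coe_add, ← EReal.coe_neg]
      simp only [EReal.real_coe_toENNReal]
      rcases le_total 0 x with hx | hx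
      · rw [ENNReal.ofReal_of_nonpos (neg_nonpos.2 hx), add_zero, ENNReal.ofReal_add hx hC]
      · rw [ENNReal.ofReal_of_nonpos hx, zero_add, ← ENNReal.ofReal_add (by linarith)
          (by linarith)]
        congr 1; ring
  have hneg : ∀ p, (-energyDensity V N ω₁ ω₂ p).toENNReal ≤ ENNReal.ofReal C := fun p => by
    rw [← EReal.real_coe_toENNReal]
    refine EReal.toENNReal_le_toENNReal ?_
    rw [EReal.neg_le, ← EReal.coe_neg]
    exact hlow p
  set P := ∫⁻ p, (energyDensity V N ω₁ ω₂ p).toENNReal ∂(μ.prod μ) with hP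
  set M := ∫⁻ p, (-energyDensity V N ω₁ ω₂ p).toENNReal ∂(μ.prod μ) with hM
  have hsum : P + ENNReal.ofReal C = pairEnergy (shiftedDensity V N ω₁ ω₂ C) μ + M := by
    have : ∫⁻ _ : ℝ × ℝ, ENNReal.ofReal C ∂(μ.prod μ) = ENNReal.ofReal C := by simp
    rw [← this, hP, hM, pairEnergy, ← lintegral_add_right _ measurable_const,
      ← lintegral_add_left hH]
    exact lintegral_congr hpt
  have hMtop : M ≠ ⊤ := by
    refine ne_top_of_le_ne_top ENNReal.ofReal_ne_top
      ((lintegral_mono hneg).trans (?_ : _ ≤ ENNReal.ofReal C))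
    simp
  rw [energy, ← hP, ← hM]
  set I := pairEnergy (shiftedDensity V N ω₁ ω₂ C) μ
  clear_value P M I
  lift M to NNReal using hMtop
  by_cases hPt : P = ⊤
  · have hI : I = ⊤ := by
      rw [hPt, top_add, eq_comm, ENNReal.add_eq_top] at hsum
      exact hsum.resolve_right ENNReal.coe_ne_top
    rw [hPt, hI, EReal.coe_ennreal_top, EReal.top_sub_coe]
    exact EReal.top_sub_coe (M : ℝ)
  · have hI : I ≠ ⊤ := fun hI => by
      rw [hI, top_add, ENNReal.add_eq_top] at hsum
      exact hsum.elim hPt ENNReal.ofReal_ne_top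
    lift P to NNReal using hPt
    lift I to NNReal using hI
    rw [ENNReal.ofReal, ← ENNReal.coe_add, ← ENNReal.coe_add, ENNReal.coe_inj] at hsum
    have hsum' : (P : ℝ) + C = I + M := by
      have := congrArg NNReal.toReal hsum
      simpa [hC] using this
    change ((P : ℝ) : EReal) - ((M : ℝ) : EReal) = ((I : ℝ) : EReal) - (C : EReal)
    rw [← EReal.coe_sub, ← EReal.coe_sub, EReal.coe_eq_coe_iff]
    linarith

theorem energy_le_energy_iff (hV : Continuous V) (hC : 0 ≤ C)
    (hlow : ∀ p, ((-C : ℝ) : EReal) ≤ energyDensity V N ω₁ ω₂ p) (μ ν : Measure ℝ)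
    [IsProbabilityMeasure μ] [IsProbabilityMeasure ν] :
    energy V N ω₁ ω₂ μ ≤ energy V N ω₁ ω₂ ν ↔ pairEnergy (shiftedDensity V N ω₁ ω₂ C) μ ≤
      pairEnergy (shiftedDensity V N ω₁ ω₂ C) ν := by
  rw [energy_eq_pairEnergy_sub hV hC hlow, energy_eq_pairEnergy_sub hV hC hlow,
    ← EReal.coe_ennreal_le_coe_ennreal_iff]
  refine ⟨fun h => ?_, fun h => EReal.sub_le_sub h le_rfl⟩
  have := add_le_add h (le_refl (C : EReal))
  rwa [EReal.sub_add_cancel, EReal.sub_add_cancel] at this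

end

theorem exists_unique_equilibriumMeasure {V : ℝ → ℝ} {m : ℝ} (hV : StrongConvexOn univ m V)
    (hm : 0 < m) {N : ℕ} (hN : 2 ≤ N) {ω₁ ω₂ : ℝ} (hω₁ : 0 < ω₁) (hω₂ : 0 < ω₂) :
    ∃ μ : Measure ℝ, IsEquilibriumMeasure V N ω₁ ω₂ μ ∧
      (∀ ν : Measure ℝ, IsEquilibriumMeasure V N ω₁ ω₂ ν → ν = μ) ∧
      ∃ a c : ℝ, a < c ∧ μ.support = Icc a c := by
  obtain ⟨C, hC, hlow, h⟩ := exists_confiningInteraction_shiftedDensity hV hm hN hω₁ hω₂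
  have hle := energy_le_energy_iff (hV.continuous_univ hm) hC hlow
  obtain ⟨μ, hμ, hfin, hmin⟩ := h.exists_minimiser
  refine ⟨μ, ⟨hμ, fun ν hν => (hle μ ν).2 (hmin ν hν)⟩, fun ν hν => ?_, h.support_eq_Icc hfin hmin⟩
  have := hν.isProbabilityMeasure
  exact h.unique_minimiser hfin hmin ((hle ν μ).1 (hν.energy_le μ hμ))

end
theorem mainTheorem8 (κ b : ℝ) (hκ : -(1 / (2 * Real.pi)) ≤ κ) (hb : 0 < b) :
    ∃ r₀ : ℝ, 0 < r₀ ∧ ∀ r : ℝ, r₀ ≤ r →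
      (∃! ε : ℝ → ℝ, IsTBASolution κ b r ε) ∧
      ∀ ε : ℝ → ℝ, IsTBASolution κ b r ε → ∀ (N : ℕ) (α : ℝ), 2 ≤ N →
        StrictConvexOn ℝ Set.univ (potential ε r α N) ∧
        ∀ ω₁ ω₂ : ℝ, 0 < ω₁ → 0 < ω₂ →
          ∃ μ : MeasureTheory.Measure ℝ,
            IsEquilibriumMeasure (potential ε r α N) N ω₁ ω₂ μ ∧
            (∀ ν : MeasureTheory.Measure ℝ,
              IsEquilibriumMeasure (potential ε r α N) N ω₁ ω₂ ν → ν = μ) ∧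
            ∃ a c : ℝ, a < c ∧ μ.support = Set.Icc a c := by
  have hs := sin_pi_div_one_add_sq_pos hb
  -- The first summand dominates `∫ g / (2π)`; the second one makes the TBA equation contracting.
  refine ⟨6 + (1 + 4 * Real.pi * |κ|) / (2 * Real.sin (Real.pi / (1 + b ^ 2))), by positivity,
    fun r hr => ?_⟩
  have h0 : 0 ≤ (1 + 4 * Real.pi * |κ|) / (2 * Real.sin (Real.pi / (1 + b ^ 2))) := by positivity
  have hr6 : 6 ≤ r := by linarith
  have hr0 : 0 ≤ r := by linarith
  have hD : 1 + 4 * Real.pi * |κ| ≤ 2 * r * Real.sin (Real.pi / (1 + b ^ 2)) := by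
    have h1 : (1 + 4 * Real.pi * |κ|) / (2 * Real.sin (Real.pi / (1 + b ^ 2))) ≤ r := by linarith
    rw [div_le_iff₀ (by positivity)] at h1
    linarith
  have hD1 : 1 ≤ 2 * r * Real.sin (Real.pi / (1 + b ^ 2)) :=
    le_trans (le_add_of_nonneg_right (by positivity)) hD
  obtain ⟨ε₀, hε₀, hclose⟩ := exists_isTBASolution (κ := κ) hb hr0 hD
  have huniq : ∀ ε, IsTBASolution κ b r ε → ε = ε₀ := fun ε hε => hε.unique hκ hb hr0 hD hε₀
  refine ⟨⟨ε₀, hε₀, huniq⟩, fun ε hε N α hN => ?_⟩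
  obtain rfl := huniq ε hε
  have hlt := integral_tbaG_lt hD1 hε.measurable hclose
  have hV := strongConvexOn_potential (α := α) hN hr0 (tbaG_nonneg ε)
    (integrable_tbaG hD1 hε.measurable hclose)
  have hm : 0 < tauN N / N * (r - (∫ x, tbaG ε x) / (2 * Real.pi)) := by
    have hN0 : (0 : ℝ) < N := by exact_mod_cast (by omega : 0 < N)
    exact mul_pos (div_pos (tauN_pos hN) hN0) (by linarith)
  exact ⟨hV.strictConvexOn hm, fun ω₁ ω₂ hω₁ hω₂ =>
    exists_unique_equilibriumMeasure hV hm hN hω₁ hω₂⟩
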